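/- **Setting.** Let $\bm M=(M,g,\mathfrak t)$ be a globally hyperbolic time-oriented Lorentzian spacetime (a smooth second countable Hausdorff manifold with a smooth metric of signature $(+,-,\dots,-)$, without closed causal curves and with compact causal diamonds $J^+(x)\cap J^-(y)$). For $S\subseteq M$ let $J^\pm(S)$ be its causal future/past, $S^\perp=M\setminus(J^+(S)\cup J^-(S))$ its causal complement, $M^\pm(S)=M\setminus J^\mp(S)$; $S$ is causally convex if $S=J^+(S)\cap J^-(S)$. A *region* is an open causally convex subset of $M$. An *AQFT* $\mathcal A$ on $\bm M$ consists of unital complex $*$-algebras $\mathcal A(\bm N)$ for all regions $N\subseteq M$ (including $N=M$) and injective unital $*$-homomorphisms $\alpha_{\bm N_1;\bm N_2}:\mathcal A(\bm N_2)\to\mathcal A(\bm N_1)$ for $N_2\subseteq N_1$ with $\alpha_{\bm N_1;\bm N_2}\circ\alpha_{\bm N_2;\bm N_3}=\alpha_{\bm N_1;\bm N_3}$, such that, with $\mathcal A(\bm M;N)$ the image of $\alpha_{\bm M;\bm N}$ (the elements that *can be localized in* $N$): * (time-slice) $\mathcal A(\bm M;N)=\mathcal A(\bm M)$ if $N$ contains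 a Cauchy surface of $\bm M$; * (Einstein causality) $\mathcal A(\bm M;N_1)$ and $\mathcal A(\bm M;N_2)$ commute if $N_1\subseteq N_2^\perp$; * (Haag property) for every compact $K$, if $A\in\mathcal A(\bm M)$ commutes with $\mathcal A(\bm M;N)$ for all regions $N\subseteq K^\perp$, then $A\in\mathcal A(\bm M;L)$ for every connected region $L\supseteq K$. Let $K\subseteq M$ be compact and let $\mathcal A$ (system), $\mathcal B$ (probe), $\mathcal C$ (coupled theory) be AQFTs on $\bm M$ with inclusion maps $\alpha,\beta,\gamma$. Suppose the coupling is localized in $K$: for each region $L\subseteq M\setminus(J^+(K)\cap J^-(K))$ there is a $*$-isomorphism $\chi_{\bm L}:\mathcal A(\bm L)\otimes\mathcal B(\bm L)\to\mathcal C(\bm L)$ (algebraic tensor product), and $\chi_{\bm L_1}\circ(\alpha_{\bm L_1;\bm L_2}\otimes\beta_{\bm L_1;\bm L_2})=\gamma_{\bm L_1;\bm L_2}\circ\chi_{\bm L_2}$ whenever $L_2\subseteq L_1$ are such regions. Write $\alpha^\pm,\beta^\pm,\gamma^\pm$ for the inclusion maps of the sets $M^\pm(K)$ into $M$ and $\chi^\pm$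 for the maps $\chi$ of $M^\pm(K)$. **Theorem (localization of induced observables).** The sets $M^\pm(K)$ are regions contained in $M\setminus(J^+(K)\cap J^-(K))$, the maps $\alpha^\pm\otimes\beta^\pm$ are bijective, and $\tau^\pm=\gamma^\pm\circ\chi^\pm\circ(\alpha^\pm\otimes\beta^\pm)^{-1}$ are $*$-isomorphisms $\mathcal A(\bm M)\otimes\mathcal B(\bm M)\to\mathcal C(\bm M)$, so that the scattering morphism $\Theta=(\tau^-)^{-1}\circ\tau^+$ is a well-defined $*$-automorphism of $\mathcal A(\bm M)\otimes\mathcal B(\bm M)$. Let $\sigma$ be a state on $\mathcal B(\bm M)$, let $\eta_\sigma:\mathcal A(\bm M)\otimes\mathcal B(\bm M)\to\mathcal A(\bm M)$ be the linear map with $\eta_\sigma(A\otimes B)=\sigma(B)A$, and put $\varepsilon_\sigma(B)=\eta_\sigma(\Theta(\mathbb 1\otimes B))$ for $B\in\mathcal B(\bm M)$. Then for every $B\in\mathcal B(\bm M)$: 1. $\varepsilon_\sigma(B)$ is an observable induced by $B$: if $\omega$ is a state on $\mathcal A(\bm M)$ and $\tilde\omega$ a state on $\mathcal C(\bm M)$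 with $\tilde\omega(\tau^-(A\otimes B'))=\omega(A)\,\sigma(B')$ for all $A\in\mathcal A(\bm M)$, $B'\in\mathcal B(\bm M)$, then $\tilde\omega(\tau^+(\mathbb 1\otimes B))=\omega(\varepsilon_\sigma(B))$; 2. $\varepsilon_\sigma(B)$ commutes with every element of $\mathcal A(\bm M;N)$ for every region $N\subseteq K^\perp$; 3. $\varepsilon_\sigma(B)\in\mathcal A(\bm M;L)$ for every connected region $L\supseteq K$, i.e. $\varepsilon_\sigma(B)$ can be localized in every connected open causally convex set that contains $K$. -/

import Mathlib

open scoped Manifold ContDiff TensorProduct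

/-- A time-oriented Lorentzian spacetime structure on a smooth manifold `M` of dimension `d`:
a smooth symmetric bilinear form on the tangent spaces of signature `(+,-,…,-)` together with
a time orientation, given by a continuous timelike vector field. -/
structure Spacetime (d : ℕ) (M : Type*) [TopologicalSpace M]
    [ChartedSpace (EuclideanSpace ℝ (Fin d)) M] [IsManifold (𝓡 d) ∞ M] where
  /-- the metric -/
  g (x : M) : TangentSpace (𝓡 d) x →L[ℝ] TangentSpace (𝓡 d) x →L[ℝ] ℝ
  symm (x : M) (v w : TangentSpace (𝓡 d) x) : g x v w = g x w v
  /-- each tangent space has a positive vector whose orthogonal complement is negative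
  definite, i.e. the signature is `(+,-,…,-)` (so `g x` is nondegenerate) -/
  lorentzian (x : M) : ∃ v : TangentSpace (𝓡 d) x, 0 < g x v v ∧
    ∀ w : TangentSpace (𝓡 d) x, w ≠ 0 → g x v w = 0 → g x w w < 0
  contMDiff : ContMDiff (𝓡 d)
    ((𝓡 d).prod 𝓘(ℝ, EuclideanSpace ℝ (Fin d) →L[ℝ] EuclideanSpace ℝ (Fin d) →L[ℝ] ℝ)) ∞
    (fun x ↦ Bundle.TotalSpace.mk'
      (EuclideanSpace ℝ (Fin d) →L[ℝ] EuclideanSpace ℝ (Fin d) →L[ℝ] ℝ) x (g x))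
  /-- the timelike vector field that points to the future -/
  T (x : M) : TangentSpace (𝓡 d) x
  T_timelike (x : M) : 0 < g x (T x) (T x)
  T_continuous : Continuous (fun x ↦ (⟨x, T x⟩ : TangentBundle (𝓡 d) M))

namespace Spacetime

variable {d : ℕ} {M : Type*} [TopologicalSpace M]
  [ChartedSpace (EuclideanSpace ℝ (Fin d)) M] [IsManifold (𝓡 d) ∞ M] (S : Spacetime d M)

/-- Future-directed causal (timelike or null, nonzero) tangent vectors. -/
def FutureCausal (x : M) (v : TangentSpace (𝓡 d) x) : Prop :=
  0 ≤ S.g x v v ∧ 0 < S.g x (S.T x) v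

/-- Future-directed timelike tangent vectors. -/
def FutureTimelike (x : M) (v : TangentSpace (𝓡 d) x) : Prop :=
  0 < S.g x v v ∧ 0 < S.g x (S.T x) v

/-- The velocity at `t` of a curve considered on `[a, b]` (one-sided at the end points). -/
noncomputable def velocity (γ : ℝ → M) (a b t : ℝ) : TangentSpace (𝓡 d) (γ t) :=
  mfderivWithin 𝓘(ℝ, ℝ) (𝓡 d) γ (Set.Icc a b) t (1 : ℝ)

/-- `γ` restricted to `[a, b]`, `a < b`, is a `C¹` future-directed causal curve. -/
def IsCausalSegment (γ : ℝ → M) (a b : ℝ) : Prop :=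
  a < b ∧ ContMDiffOn 𝓘(ℝ, ℝ) (𝓡 d) 1 γ (Set.Icc a b) ∧
    ∀ t ∈ Set.Icc a b, S.FutureCausal (γ t) (velocity γ a b t)

/-- `γ` restricted to `[a, b]`, `a < b`, is a `C¹` future-directed timelike curve. -/
def IsTimelikeSegment (γ : ℝ → M) (a b : ℝ) : Prop :=
  a < b ∧ ContMDiffOn 𝓘(ℝ, ℝ) (𝓡 d) 1 γ (Set.Icc a b) ∧
    ∀ t ∈ Set.Icc a b, S.FutureTimelike (γ t) (velocity γ a b t)

/-- There is a `C¹` future-directed causal curve from `x` to `y`. -/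
def CausalStep (x y : M) : Prop :=
  ∃ (γ : ℝ → M) (a b : ℝ), S.IsCausalSegment γ a b ∧ γ a = x ∧ γ b = y

/-- The causal future of a point: the points reached from `x` by future-directed piecewise `C¹`
causal curves (finite concatenations of `C¹` ones), together with `x` itself. -/
def JplusPt (x : M) : Set M := {y | Relation.ReflTransGen S.CausalStep x y}

/-- The causal past of a point. -/
def JminusPt (x : M) : Set M := {y | Relation.ReflTransGen S.CausalStep y x}

/-- The causal future of a set. -/
def Jplus (R : Set M) : Set M := ⋃ x ∈ R, S.JplusPt x

/-- The causal past of a set. -/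
def Jminus (R : Set M) : Set M := ⋃ x ∈ R, S.JminusPt x

/-- The causal hull of a set. -/
def causalHull (R : Set M) : Set M := S.Jplus R ∩ S.Jminus R

/-- A set is causally convex if it equals its causal hull. -/
def CausallyConvex (R : Set M) : Prop := R = S.Jplus R ∩ S.Jminus R

/-- The causal complement `M ∖ (J⁺(R) ∪ J⁻(R))`. -/
def causalComplement (R : Set M) : Set M := (S.Jplus R ∪ S.Jminus R)ᶜ

/-- The "out" region `M⁺(R) = M ∖ J⁻(R)`. -/
def outRegion (R : Set M) : Set M := (S.Jminus R)ᶜ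

/-- The "in" region `M⁻(R) = M ∖ J⁺(R)`. -/
def inRegion (R : Set M) : Set M := (S.Jplus R)ᶜ

/-- Global hyperbolicity: there are no closed causal curves and all causal diamonds
`J⁺(x) ∩ J⁻(y)` are compact. -/
def GloballyHyperbolic : Prop :=
  (∀ x : M, ¬ Relation.TransGen S.CausalStep x x) ∧
    ∀ x y : M, IsCompact (S.JplusPt x ∩ S.JminusPt y)

/-- An inextendible future-directed piecewise `C¹` timelike curve, parametrized by the whole real
line (its domain is an open interval, which can be reparametrized in this way): every compact
parameter interval splits into finitely many pieces on which `γ` is `C¹` and timelike,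
and `γ` has no future and no past end point. -/
def IsInextendibleTimelike (γ : ℝ → M) : Prop :=
  (∀ a b : ℝ, a < b → Relation.TransGen (S.IsTimelikeSegment γ) a b) ∧
    (¬ ∃ p : M, Filter.Tendsto γ Filter.atTop (nhds p)) ∧
    ¬ ∃ p : M, Filter.Tendsto γ Filter.atBot (nhds p)

/-- A Cauchy surface: a set met exactly once by every inextendible timelike curve. -/
def IsCauchySurface (Sig : Set M) : Prop :=
  ∀ γ : ℝ → M, S.IsInextendibleTimelike γ → ∃! t : ℝ, γ t ∈ Sig

/-- The open causally convex subsets of the spacetime. -/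
structure Region where
  carrier : Set M
  isOpen : IsOpen carrier
  causallyConvex : S.CausallyConvex carrier

/-- The whole spacetime as a region. -/
def top : S.Region where
  carrier := Set.univ
  isOpen := isOpen_univ
  causallyConvex := by
    refine (Set.eq_univ_of_forall fun x ↦ Set.mem_inter ?_ ?_).symm
    · exact Set.mem_biUnion (Set.mem_univ x) Relation.ReflTransGen.refl
    · exact Set.mem_biUnion (Set.mem_univ x) Relation.ReflTransGen.refl

end Spacetime

section AQFT

variable {d : ℕ} {M : Type*} [TopologicalSpace M]
  [ChartedSpace (EuclideanSpace ℝ (Fin d)) M] [IsManifold (𝓡 d) ∞ M]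

/-- The data of an algebraic quantum field theory on the spacetime `S` and on its open causally
convex subsets `N` (with the inherited metric and time orientation): a unital complex
`*`-algebra `Obj N` for each `N`, and compatible injective unital `*`-homomorphisms
`map N₁ N₂ : Obj N₂ → Obj N₁` for `N₂ ⊆ N₁`. -/
structure LocalNet (S : Spacetime d M) where
  Obj : S.Region → Type*
  [ring : ∀ N, Ring (Obj N)]
  [algebra : ∀ N, Algebra ℂ (Obj N)]
  [starRing : ∀ N, StarRing (Obj N)]
  [starModule : ∀ N, StarModule ℂ (Obj N)]
  map (N₁ N₂ : S.Region) (h : N₂.carrier ⊆ N₁.carrier) : Obj N₂ →⋆ₐ[ℂ] Obj N₁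
  map_injective (N₁ N₂ : S.Region) (h : N₂.carrier ⊆ N₁.carrier) :
    Function.Injective (map N₁ N₂ h)
  map_map (N₁ N₂ N₃ : S.Region) (h₁₂ : N₂.carrier ⊆ N₁.carrier)
    (h₂₃ : N₃.carrier ⊆ N₂.carrier) (a : Obj N₃) :
    map N₁ N₂ h₁₂ (map N₂ N₃ h₂₃ a) = map N₁ N₃ (h₂₃.trans h₁₂) a

attribute [instance] LocalNet.ring LocalNet.algebra LocalNet.starRing LocalNet.starModule

namespace LocalNet

variable {S : Spacetime d M} (A : LocalNet S)

/-- The global algebra `A(M)`. -/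
abbrev Global : Type _ := A.Obj S.top

/-- The inclusion map `A(N) → A(M)`. -/
def incl (N : S.Region) : A.Obj N →⋆ₐ[ℂ] A.Global := A.map S.top N (Set.subset_univ _)

/-- The sub-`*`-algebra `A(M; N)` of the elements of `A(M)` that can be localized in `N`. -/
def localAlg (N : S.Region) : StarSubalgebra ℂ A.Global := (A.incl N).range

/-- Isotony. -/
theorem localAlg_mono (N₁ N₂ : S.Region) (h : N₁.carrier ⊆ N₂.carrier) :
    A.localAlg N₁ ≤ A.localAlg N₂ := by
  rintro _ ⟨a, rfl⟩
  exact ⟨A.map N₂ N₁ h a, A.map_map S.top N₂ N₁ (Set.subset_univ _) h a⟩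

end LocalNet

/-- An algebraic quantum field theory: isotony and compatibility are built into `LocalNet`. -/
structure AQFT (S : Spacetime d M) extends LocalNet S where
  time_slice (N : S.Region) :
    (∃ Sig : Set M, S.IsCauchySurface Sig ∧ Sig ⊆ N.carrier) → toLocalNet.localAlg N = ⊤
  einstein_causality (N₁ N₂ : S.Region) : N₁.carrier ⊆ S.causalComplement N₂.carrier →
    ∀ a ∈ toLocalNet.localAlg N₁, ∀ b ∈ toLocalNet.localAlg N₂, a * b = b * a
  haag (K : Set M) : IsCompact K → ∀ a : toLocalNet.Global,
    (∀ N : S.Region, N.carrier ⊆ S.causalComplement K →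
      ∀ b ∈ toLocalNet.localAlg N, a * b = b * a) →
    ∀ L : S.Region, IsConnected L.carrier → K ⊆ L.carrier → a ∈ toLocalNet.localAlg L

/-- A state on a unital complex `*`-algebra. -/
structure AlgState (R : Type*) [Ring R] [Algebra ℂ R] [StarRing R] where
  toFun : R →ₗ[ℂ] ℂ
  nonneg (a : R) : 0 ≤ (toFun (star a * a)).re ∧ (toFun (star a * a)).im = 0
  map_one : toFun 1 = 1

variable {S : Spacetime d M}

/-- The maps `α ⊗ β : A(N₂) ⊗ B(N₂) → A(N₁) ⊗ B(N₁)` of the uncoupled theory. -/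
noncomputable def uncoupledMap (A B : AQFT S) (N₁ N₂ : S.Region)
    (h : N₂.carrier ⊆ N₁.carrier) :
    (A.Obj N₂ ⊗[ℂ] B.Obj N₂) →ₐ[ℂ] (A.Obj N₁ ⊗[ℂ] B.Obj N₁) :=
  Algebra.TensorProduct.map (A.map N₁ N₂ h).toAlgHom (B.map N₁ N₂ h).toAlgHom

/-- `C` is a coupling of the system theory `A` to the probe theory `B` that is localized in `K`:
on the open causally convex regions outside the causal hull of `K` the coupled theory is
identified with the uncoupled one, compatibly with the inclusions of such regions. -/
structure Coupling (A B C : AQFT S) (K : Set M) where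
  chi (L : S.Region) (hL : L.carrier ⊆ (S.causalHull K)ᶜ) :
    (A.Obj L ⊗[ℂ] B.Obj L) ≃⋆ₐ[ℂ] C.Obj L
  natural (L₁ L₂ : S.Region) (h : L₂.carrier ⊆ L₁.carrier)
    (h₁ : L₁.carrier ⊆ (S.causalHull K)ᶜ) (h₂ : L₂.carrier ⊆ (S.causalHull K)ᶜ)
    (x : A.Obj L₂ ⊗[ℂ] B.Obj L₂) :
    chi L₁ h₁ (uncoupledMap A B L₁ L₂ h x) = C.map L₁ L₂ h (chi L₂ h₂ x)

namespace Coupling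

variable {A B C : AQFT S} {K : Set M} (X : Coupling A B C K)

/-- `τ = κ ∘ (α ⊗ β)⁻¹` with `κ = γ ∘ χ`, where `α`, `β`, `γ` are the inclusion maps
and `χ` the identification for the region `R`. The property includes that `R` is an
open causally convex region outside the causal hull of `K` and that `α ⊗ β` is invertible. -/
def IsResponseMap (R : Set M)
    (τ : (A.Global ⊗[ℂ] B.Global) ≃⋆ₐ[ℂ] C.Global) : Prop :=
  ∃ (N : S.Region) (hN : N.carrier ⊆ (S.causalHull K)ᶜ), N.carrier = R ∧
    Function.Bijective (uncoupledMap A B S.top N (Set.subset_univ _)) ∧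
    ∀ x : A.Obj N ⊗[ℂ] B.Obj N,
      τ (uncoupledMap A B S.top N (Set.subset_univ _) x) = C.incl N (X.chi N hN x)

/-- `τ` is the retarded response map `τ⁺`, built from the "out" region `M⁺(K)`. -/
def IsRetardedResponse (τ : (A.Global ⊗[ℂ] B.Global) ≃⋆ₐ[ℂ] C.Global) : Prop :=
  X.IsResponseMap (S.outRegion K) τ

/-- `τ` is the advanced response map `τ⁻`, built from the "in" region `M⁻(K)`. -/
def IsAdvancedResponse (τ : (A.Global ⊗[ℂ] B.Global) ≃⋆ₐ[ℂ] C.Global) : Prop :=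
  X.IsResponseMap (S.inRegion K) τ

end Coupling

/-- The scattering morphism `Θ = (τ⁻)⁻¹ ∘ τ⁺`. -/
def scatteringMorphism {A B C : AQFT S}
    (τp τm : (A.Global ⊗[ℂ] B.Global) ≃⋆ₐ[ℂ] C.Global) :
    (A.Global ⊗[ℂ] B.Global) ≃⋆ₐ[ℂ] (A.Global ⊗[ℂ] B.Global) :=
  τp.trans τm.symm

/-- The linear map `η_σ : A(M) ⊗ B(M) → A(M)`, `η_σ (a ⊗ b) = σ(b) a`. -/
noncomputable def etaMap (A B : AQFT S) (σ : AlgState B.Global) :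
    (A.Global ⊗[ℂ] B.Global) →ₗ[ℂ] A.Global :=
  (TensorProduct.rid ℂ A.Global).toLinearMap ∘ₗ TensorProduct.map LinearMap.id σ.toFun

theorem etaMap_tmul (A B : AQFT S) (σ : AlgState B.Global) (a : A.Global) (b : B.Global) :
    etaMap A B σ (a ⊗ₜ[ℂ] b) = σ.toFun b • a := by
  simp [etaMap]

/-- The induced observable `ε_σ(b) = η_σ(Θ(1 ⊗ b))` of the probe observable `b`. -/
noncomputable def inducedObservable (A B : AQFT S)
    (Θ : (A.Global ⊗[ℂ] B.Global) ≃⋆ₐ[ℂ] (A.Global ⊗[ℂ] B.Global))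
    (σ : AlgState B.Global) (b : B.Global) : A.Global :=
  etaMap A B σ (Θ (1 ⊗ₜ[ℂ] b))

end AQFT

/-!
The algebraic part is short. If the region `N` contains a Cauchy surface, the time-slice property
makes the inclusions of `A(N)`, `B(N)` and `C(N)` bijective, so that `γ ∘ χ ∘ (α ⊗ β)⁻¹` is a
`*`-isomorphism (`Coupling.existsUnique_isResponseMap`). By naturality of `χ` both response maps
agree with `γ ∘ χ` on observables localized in the causal complement of `K`, which lies in both
exterior regions `M⁺(K)` and `M⁻(K)`; hence the scattering morphism `Θ` fixes `a ⊗ 1` for such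
`a` (`Coupling.scatteringMorphism_tmul_one`). Since `Θ` is multiplicative, `Θ (1 ⊗ b)` commutes
with `a ⊗ 1`; since `η_σ` is a bimodule map over `A(M)`, the induced observable commutes with
`a`, and the Haag property localizes it.

The geometric part is to show that `M⁺(K)` and `M⁻(K)` are open and contain Cauchy surfaces. Three
local facts suffice. End points of timelike curves are interior points of each other's causal
future and past (`Spacetime.IsTimelikeSegment.chron`). Every point is a limit of points in its
chronological future and past. The interior of `J⁻(z)` is a past set, and dually
(`Spacetime.CausalStep.mem_interior_JminusPt`); for this a causal curve is pushed off itself along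
the time orientation at an exponential rate that outweighs the variation of the metric in a chart.

The rest is order theory, carried out for an abstract relation in `IsGloballyHyperbolicOrder`. The
causal relation is closed, so `J⁻(K)` is closed for compact `K`, and an inextendible timelike
curve leaves the past of every point. With the help of a sequence of points a future set `F` is
then written down whose closure is disjoint from `J⁻(K)` and such that every inextendible timelike
curve starts outside of `F` and enters it. The boundary of `F` is the Cauchy surface
(`IsGloballyHyperbolicOrder.exists_met_once`). Time reversal gives `M⁻(K)`.
-/

open Filter Topology

/-! ### The metric and causal curves in a chart -/

namespace Spacetime

variable {d : ℕ} {M : Type*} [TopologicalSpace M]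
  [ChartedSpace (EuclideanSpace ℝ (Fin d)) M]

theorem tendsto_chart_symm_add_smul {x₀ x : M} (hx : x ∈ (extChartAt (𝓡 d) x₀).source)
    (V : EuclideanSpace ℝ (Fin d)) :
    Tendsto (fun e : ℝ ↦ (extChartAt (𝓡 d) x₀).symm (extChartAt (𝓡 d) x₀ x + e • V))
      (𝓝 0) (𝓝 x) := by
  have h1 : Tendsto (fun e : ℝ ↦ extChartAt (𝓡 d) x₀ x + e • V) (𝓝 0)
      (𝓝 (extChartAt (𝓡 d) x₀ x)) := by
    have : Continuous fun e : ℝ ↦ extChartAt (𝓡 d) x₀ x + e • V := by fun_prop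
    have := this.tendsto 0
    rwa [zero_smul, add_zero] at this
  have h2 := (continuousAt_extChartAt_symm' (I := 𝓡 d) hx).tendsto.comp h1
  rwa [(extChartAt (𝓡 d) x₀).left_inv hx] at h2

variable [IsManifold (𝓡 d) ∞ M] (S : Spacetime d M)

/-- The coordinate frame of the chart at `x₀`: it sends the components of a tangent vector at `x`
to the vector itself. It is the inverse of the trivialization of the tangent bundle at `x₀`, so
that it is meaningful only for `x` in the domain of the chart. -/
noncomputable def chartFrame (x₀ x : M) : EuclideanSpace ℝ (Fin d) →L[ℝ] TangentSpace (𝓡 d) x :=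
  (trivializationAt (EuclideanSpace ℝ (Fin d)) (TangentSpace (𝓡 d)) x₀).symmL ℝ x

/-- The components of a tangent vector at `x` in the chart at `x₀`. -/
noncomputable def chartCoord (x₀ x : M) : TangentSpace (𝓡 d) x →L[ℝ] EuclideanSpace ℝ (Fin d) :=
  (trivializationAt (EuclideanSpace ℝ (Fin d)) (TangentSpace (𝓡 d)) x₀).continuousLinearMapAt ℝ x

theorem chartFrame_chartCoord {x₀ x : M} (hx : x ∈ (extChartAt (𝓡 d) x₀).source)
    (v : TangentSpace (𝓡 d) x) : chartFrame x₀ x (chartCoord x₀ x v) = v := by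
  rw [extChartAt_source] at hx
  exact (trivializationAt (EuclideanSpace ℝ (Fin d))
    (TangentSpace (𝓡 d)) x₀).symmL_continuousLinearMapAt (by simpa using hx) v

theorem chartCoord_chartFrame {x₀ x : M} (hx : x ∈ (extChartAt (𝓡 d) x₀).source)
    (v : EuclideanSpace ℝ (Fin d)) : chartCoord x₀ x (chartFrame x₀ x v) = v := by
  rw [extChartAt_source] at hx
  exact (trivializationAt (EuclideanSpace ℝ (Fin d))
    (TangentSpace (𝓡 d)) x₀).continuousLinearMapAt_symmL (by simpa using hx) v

/-- The metric in the chart at `x₀`, as a bilinear form on `ℝᵈ` that depends on the point `u` of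
the target of the chart. It is built from a linear map because the tangent spaces carry no
norm. -/
noncomputable def chartMetric (x₀ : M) (u : EuclideanSpace ℝ (Fin d)) :
    EuclideanSpace ℝ (Fin d) →L[ℝ] EuclideanSpace ℝ (Fin d) →L[ℝ] ℝ :=
  LinearMap.toContinuousLinearMap
    { toFun := fun v ↦
        (S.g ((extChartAt (𝓡 d) x₀).symm u) (chartFrame x₀ _ v)).comp (chartFrame x₀ _)
      map_add' := fun v w ↦ by
        rw [map_add, map_add]
        rfl
      map_smul' := fun r v ↦ by
        rw [map_smul, map_smul]
        rfl }

theorem chartMetric_apply (x₀ : M) (u v w : EuclideanSpace ℝ (Fin d)) :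
    S.chartMetric x₀ u v w = S.g ((extChartAt (𝓡 d) x₀).symm u) (chartFrame x₀ _ v)
      (chartFrame x₀ _ w) := rfl

/-- The components, in the chart at `x₀`, of the vector field that gives the time orientation. -/
noncomputable def chartTime (x₀ : M) (u : EuclideanSpace ℝ (Fin d)) :
    EuclideanSpace ℝ (Fin d) :=
  chartCoord x₀ ((extChartAt (𝓡 d) x₀).symm u) (S.T _)

theorem contMDiffOn_chartFrame (x₀ : M) (v : EuclideanSpace ℝ (Fin d)) :
    ContMDiffOn (𝓡 d) ((𝓡 d).prod (𝓡 d)) 1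
      (fun x ↦ (Bundle.TotalSpace.mk' (EuclideanSpace ℝ (Fin d)) x (chartFrame x₀ x v) :
        TangentBundle (𝓡 d) M))
      (extChartAt (𝓡 d) x₀).source := by
  have : IsManifold (𝓡 d) (1 + 1) M := IsManifold.of_le (n := ∞) (by norm_cast)
  have h := (trivializationAt (EuclideanSpace ℝ (Fin d))
    (TangentSpace (𝓡 d) : M → Type _) x₀).contMDiffOn_symmL (𝕜 := ℝ) (IB := 𝓡 d) (n := 1)
  have hconst : ContMDiffOn (𝓡 d) ((𝓡 d).prod (𝓡 d)) 1
      (fun x : M ↦ Bundle.TotalSpace.mk' (EuclideanSpace ℝ (Fin d))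
        (E := Bundle.Trivial M (EuclideanSpace ℝ (Fin d))) x v)
      (extChartAt (𝓡 d) x₀).source := by
    intro x hx
    rw [Bundle.contMDiffWithinAt_totalSpace]
    exact ⟨contMDiffWithinAt_id, contMDiffWithinAt_const⟩
  exact ContMDiffOn.clm_bundle_apply (b := fun x : M ↦ x)
    (E₁ := Bundle.Trivial M (EuclideanSpace ℝ (Fin d))) (E₂ := (TangentSpace (𝓡 d) : M → Type _))
    (h.mono (s := (trivializationAt (EuclideanSpace ℝ (Fin d))
      (TangentSpace (𝓡 d) : M → Type _) x₀).baseSet) (by rw [extChartAt_source]; simp)) hconst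

theorem contDiffOn_chartMetric (x₀ : M) :
    ContDiffOn ℝ 1 (S.chartMetric x₀) (extChartAt (𝓡 d) x₀).target := by
  rw [contDiffOn_clm_apply]
  intro v
  rw [contDiffOn_clm_apply]
  intro w
  rw [← contMDiffOn_iff_contDiffOn]
  have h1 : ContMDiffOn (𝓡 d) 𝓘(ℝ, ℝ) 1
      (fun x ↦ S.g x (chartFrame x₀ x v) (chartFrame x₀ x w)) (extChartAt (𝓡 d) x₀).source := by
    have := ContMDiffOn.clm_bundle_apply₂ (b := fun x : M ↦ x) (E₃ := Bundle.Trivial M ℝ)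
      (S.contMDiff.contMDiffOn.of_le (by norm_cast)) (contMDiffOn_chartFrame x₀ v)
      (contMDiffOn_chartFrame x₀ w)
    intro x hx
    have h := this x hx
    rw [Bundle.contMDiffWithinAt_totalSpace] at h
    exact h.2
  exact h1.comp ((contMDiffOn_extChartAt_symm (n := ∞) x₀).of_le (by norm_cast))
    (fun _ hu ↦ (extChartAt (𝓡 d) x₀).map_target hu)

theorem continuousOn_chartTime (x₀ : M) :
    ContinuousOn (S.chartTime x₀) (extChartAt (𝓡 d) x₀).target := by
  have h1 : ContinuousOn (fun x ↦ chartCoord x₀ x (S.T x)) (extChartAt (𝓡 d) x₀).source := by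
    have h := ((trivializationAt (EuclideanSpace ℝ (Fin d))
      (TangentSpace (𝓡 d) : M → Type _) x₀).continuousOn).comp S.T_continuous.continuousOn
        (s := (extChartAt (𝓡 d) x₀).source) (fun x hx ↦ by
        rw [extChartAt_source] at hx
        simpa using hx)
    refine (continuous_snd.comp_continuousOn h).congr fun x hx ↦ ?_
    rw [extChartAt_source] at hx
    simp only [chartCoord, Function.comp]
    rw [Bundle.Trivialization.continuousLinearMapAt_apply,
      Bundle.Trivialization.coe_linearMapAt_of_mem]
    simpa using hx
  exact h1.comp (continuousOn_extChartAt_symm x₀) (fun _ hu ↦ (extChartAt (𝓡 d) x₀).map_target hu)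

theorem chartMetric_chartTime {x₀ : M} {u : EuclideanSpace ℝ (Fin d)}
    (hu : u ∈ (extChartAt (𝓡 d) x₀).target) (w : EuclideanSpace ℝ (Fin d)) :
    S.chartMetric x₀ u (S.chartTime x₀ u) w =
      S.g ((extChartAt (𝓡 d) x₀).symm u) (S.T _) (chartFrame x₀ _ w) := by
  simp only [chartMetric_apply, chartTime]
  rw [chartFrame_chartCoord ((extChartAt (𝓡 d) x₀).map_target hu)]

theorem chartMetric_symm (x₀ : M) (u v w : EuclideanSpace ℝ (Fin d)) :
    S.chartMetric x₀ u v w = S.chartMetric x₀ u w v := S.symm _ _ _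

theorem IsCausalSegment.mono {S : Spacetime d M} {γ : ℝ → M} {a b s t : ℝ}
    (h : S.IsCausalSegment γ a b) (hs : a ≤ s) (hst : s < t) (ht : t ≤ b) :
    S.IsCausalSegment γ s t := by
  have hsub : Set.Icc s t ⊆ Set.Icc a b := Set.Icc_subset_Icc hs ht
  refine ⟨hst, h.2.1.mono hsub, fun r hr ↦ ?_⟩
  have : velocity (d := d) γ s t r = velocity γ a b r := by
    unfold velocity
    rw [mfderivWithin_subset hsub ((uniqueDiffOn_Icc hst).uniqueMDiffOn r hr)
      ((h.2.1 r (hsub hr)).mdifferentiableWithinAt one_ne_zero)]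
  rw [this]
  exact h.2.2 r (hsub hr)

theorem IsTimelikeSegment.isCausalSegment {S : Spacetime d M} {γ : ℝ → M} {a b : ℝ}
    (h : S.IsTimelikeSegment γ a b) :
    S.IsCausalSegment γ a b :=
  ⟨h.1, h.2.1, fun t ht ↦ ⟨(h.2.2 t ht).1.le, (h.2.2 t ht).2⟩⟩

/-- A `C¹` curve in the target of a chart whose derivative is causal and future-directed for the
metric in the chart joins causally related points. -/
theorem causalStep_of_chart {x₀ : M} {c : ℝ → EuclideanSpace ℝ (Fin d)} {a b : ℝ} (hab : a < b)
    (hc : ContDiffOn ℝ 1 c (Set.Icc a b))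
    (hmaps : Set.MapsTo c (Set.Icc a b) (extChartAt (𝓡 d) x₀).target)
    (hpos : ∀ t ∈ Set.Icc a b, 0 ≤ S.chartMetric x₀ (c t) (derivWithin c (Set.Icc a b) t)
      (derivWithin c (Set.Icc a b) t) ∧
      0 < S.chartMetric x₀ (c t) (S.chartTime x₀ (c t)) (derivWithin c (Set.Icc a b) t)) :
    S.CausalStep ((extChartAt (𝓡 d) x₀).symm (c a)) ((extChartAt (𝓡 d) x₀).symm (c b)) := by
  refine ⟨fun t ↦ (extChartAt (𝓡 d) x₀).symm (c t), a, b, ⟨hab, ?_, fun t ht ↦ ?_⟩, rfl, rfl⟩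
  · exact ((contMDiffOn_extChartAt_symm (n := ∞) x₀).of_le (by norm_cast)).comp
      hc.contMDiffOn hmaps
  · have hv : velocity (fun t ↦ (extChartAt (𝓡 d) x₀).symm (c t)) a b t =
        chartFrame x₀ _ (derivWithin c (Set.Icc a b) t) := by
      unfold velocity chartFrame
      have hu := (extChartAt (𝓡 d) x₀).map_target (hmaps ht)
      rw [extChartAt_source] at hu
      rw [TangentBundle.symmL_trivializationAt hu, (extChartAt (𝓡 d) x₀).right_inv (hmaps ht)]
      have := mfderivWithin_comp (I := 𝓘(ℝ, ℝ)) (I' := 𝓘(ℝ, EuclideanSpace ℝ (Fin d)))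
        (I'' := 𝓡 d) (u := Set.range (𝓡 d)) t
        (mdifferentiableWithinAt_extChartAt_symm (hmaps ht))
        ((hc.contMDiffOn t ht).mdifferentiableWithinAt one_ne_zero) (fun _ _ ↦ by simp)
        ((uniqueDiffOn_Icc hab).uniqueMDiffOn t ht)
      erw [this]
      rw [mfderivWithin_eq_fderivWithin]
      rfl
    obtain ⟨h1, h2⟩ := hpos t ht
    rw [chartMetric_chartTime _ (hmaps ht)] at h2
    unfold FutureCausal
    rw [hv]
    exact ⟨h1, h2⟩

theorem chartFrame_derivWithin {x₀ : M} {γ : ℝ → M} {a b : ℝ} (hab : a < b)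
    (hγ : ContMDiffOn 𝓘(ℝ, ℝ) (𝓡 d) 1 γ (Set.Icc a b)) {t : ℝ} (ht : t ∈ Set.Icc a b)
    (hmaps : γ t ∈ (extChartAt (𝓡 d) x₀).source) :
    chartFrame x₀ (γ t) (derivWithin (fun t ↦ extChartAt (𝓡 d) x₀ (γ t)) (Set.Icc a b) t) =
      velocity γ a b t := by
  have hd : derivWithin (fun t ↦ extChartAt (𝓡 d) x₀ (γ t)) (Set.Icc a b) t =
      chartCoord x₀ (γ t) (velocity γ a b t) := by
    unfold velocity chartCoord
    have hu := hmaps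
    rw [extChartAt_source] at hu
    rw [TangentBundle.continuousLinearMapAt_trivializationAt hu]
    have := mfderiv_comp_mfderivWithin (I := 𝓘(ℝ, ℝ)) (I' := 𝓡 d)
      (I'' := 𝓘(ℝ, EuclideanSpace ℝ (Fin d))) t (mdifferentiableAt_extChartAt hu)
      ((hγ t ht).mdifferentiableWithinAt one_ne_zero)
      ((uniqueDiffOn_Icc hab).uniqueMDiffOn t ht)
    rw [mfderivWithin_eq_fderivWithin] at this
    exact congrArg (fun L ↦ L (1 : ℝ)) this
  rw [hd, chartFrame_chartCoord hmaps]

theorem chartMetric_extChartAt {x₀ x : M} (hx : x ∈ (extChartAt (𝓡 d) x₀).source)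
    (v w : EuclideanSpace ℝ (Fin d)) :
    S.chartMetric x₀ (extChartAt (𝓡 d) x₀ x) v w =
      S.g x (chartFrame x₀ x v) (chartFrame x₀ x w) := by
  rw [chartMetric_apply, (extChartAt (𝓡 d) x₀).left_inv hx]

theorem chartMetric_chartTime_extChartAt {x₀ x : M} (hx : x ∈ (extChartAt (𝓡 d) x₀).source)
    (w : EuclideanSpace ℝ (Fin d)) :
    S.chartMetric x₀ (extChartAt (𝓡 d) x₀ x) (S.chartTime x₀ (extChartAt (𝓡 d) x₀ x)) w =
      S.g x (S.T x) (chartFrame x₀ x w) := by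
  rw [chartMetric_chartTime _ ((extChartAt (𝓡 d) x₀).map_source hx),
    (extChartAt (𝓡 d) x₀).left_inv hx]

theorem contDiffOn_chart {x₀ : M} {γ : ℝ → M} {s : Set ℝ}
    (hγ : ContMDiffOn 𝓘(ℝ, ℝ) (𝓡 d) 1 γ s) (hmaps : Set.MapsTo γ s (extChartAt (𝓡 d) x₀).source) :
    ContDiffOn ℝ 1 (fun t ↦ extChartAt (𝓡 d) x₀ (γ t)) s := by
  rw [← contMDiffOn_iff_contDiffOn]
  exact ((contMDiffOn_extChartAt (n := ∞)).of_le (by norm_cast)).comp hγ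
    (by rwa [← extChartAt_source (𝓡 d)])

theorem hasDerivWithinAt_chart {x₀ : M} {γ : ℝ → M} {a b t : ℝ}
    (hγ : ContMDiffOn 𝓘(ℝ, ℝ) (𝓡 d) 1 γ (Set.Icc a b)) (ht : t ∈ Set.Icc a b)
    (hmaps : γ t ∈ (extChartAt (𝓡 d) x₀).source) :
    HasDerivWithinAt (fun t ↦ extChartAt (𝓡 d) x₀ (γ t))
      (derivWithin (fun t ↦ extChartAt (𝓡 d) x₀ (γ t)) (Set.Icc a b) t) (Set.Icc a b) t := by
  have hu := hmaps
  rw [extChartAt_source] at hu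
  have := (mdifferentiableAt_extChartAt (I := 𝓡 d) hu).comp_mdifferentiableWithinAt t
    ((hγ t ht).mdifferentiableWithinAt one_ne_zero)
  exact this.differentiableWithinAt.hasDerivWithinAt

end Spacetime

/-! ### Estimates for fields of bilinear forms -/

section Cone

variable {E : Type*} [NormedAddCommGroup E] [NormedSpace ℝ E]

/-- Let `G` be a continuous field of bilinear forms and `τ` a continuous vector field such that no
nonzero vector is causal and orthogonal to `τ` at `u₀`. Then for all `u` near `u₀` the sign of
`G u (τ u) w` on causal vectors `w` can be read off with the constant vector `τ u₀`, and the
latter product bounds the norm of future-directed causal vectors. -/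
theorem exists_uniform_cone_bound [FiniteDimensional ℝ E] {G : E → E →L[ℝ] E →L[ℝ] ℝ}
    {τ : E → E} {u₀ : E}
    (hG : ContinuousAt G u₀) (hτ : ContinuousAt τ u₀)
    (h : ∀ w, 0 ≤ G u₀ w w → G u₀ (τ u₀) w = 0 → w = 0) :
    ∃ a > 0, ∀ᶠ u in 𝓝 u₀, ∀ w, 0 ≤ G u w w →
      (0 < G u (τ u) w → a * ‖w‖ ≤ G u (τ u₀) w) ∧ (0 < G u (τ u₀) w → 0 < G u (τ u) w) := by
  -- on the unit sphere a vector is either spacelike or not orthogonal to `τ`, uniformly so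
  have hcont : Continuous fun w ↦ max (-(G u₀ w w)) |G u₀ (τ u₀) w| := by fun_prop
  obtain ⟨m, hm, hbound⟩ := (isCompact_sphere (0 : E) 1).exists_forall_le' (a := 0)
    hcont.continuousOn (fun w hw ↦ by
      by_contra! hle
      obtain ⟨h1, h2⟩ := max_le_iff.1 hle
      have h3 := h w (by linarith) (abs_nonpos_iff.1 h2)
      rw [h3] at hw
      simp at hw)
  have hV : ContinuousAt (fun u ↦ G u (τ u₀)) u₀ := hG.clm_apply continuousAt_const
  have hVτ : ContinuousAt (fun u ↦ G u (τ u)) u₀ := hG.clm_apply hτ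
  have e1 := (tendsto_iff_norm_sub_tendsto_zero (E := E →L[ℝ] E →L[ℝ] ℝ).1 hG).eventually_lt_const
    (show (0 : ℝ) < m / 3 by linarith)
  have e2 := (tendsto_iff_norm_sub_tendsto_zero.1 hV).eventually_lt_const
    (show (0 : ℝ) < m / 3 by linarith)
  have e3 := (tendsto_iff_norm_sub_tendsto_zero.1 hVτ).eventually_lt_const
    (show (0 : ℝ) < m / 3 by linarith)
  refine ⟨m / 3, by linarith, ?_⟩
  filter_upwards [e1, e2, e3] with u h1 h2 h3
  have unit : ∀ e : E, ‖e‖ = 1 → 0 ≤ G u e e →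
      (0 < G u (τ u) e → m / 3 ≤ G u (τ u₀) e) ∧ (0 < G u (τ u₀) e → 0 < G u (τ u) e) := by
    intro e he hee
    have d1 := (G u - G u₀).le_opNorm₂ e e
    have d2 := (G u (τ u₀) - G u₀ (τ u₀)).le_opNorm e
    have d3 := (G u (τ u) - G u₀ (τ u₀)).le_opNorm e
    simp only [sub_apply, Real.norm_eq_abs, he, mul_one] at d1 d2 d3
    have d1 := abs_le.1 (d1.trans h1.le)
    have d2 := abs_le.1 (d2.trans h2.le)
    have d3 := abs_le.1 (d3.trans h3.le)
    have hb : m ≤ |G u₀ (τ u₀) e| := (le_max_iff.1 (hbound e (by simp [he]))).resolve_left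
      (by linarith [d1.2])
    rcases le_abs'.1 hb with hb | hb
    · exact ⟨fun h ↦ by linarith [d3.2], fun h ↦ by linarith [d2.2]⟩
    · exact ⟨fun h ↦ by linarith [d2.1], fun h ↦ by linarith [d3.1]⟩
  intro w hw
  rcases eq_or_ne w 0 with rfl | hw0
  · simp
  have hn : 0 < ‖w‖ := norm_pos_iff.2 hw0
  obtain ⟨k1, k2⟩ := unit (‖w‖⁻¹ • w) (by simp [norm_smul, hn.ne']) (by
    simp only [map_smul, FunLike.coe_smul, Pi.smul_apply, smul_eq_mul]; positivity)
  simp only [map_smul, smul_eq_mul] at k1 k2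
  refine ⟨fun h ↦ ?_, fun h ↦ ?_⟩
  · have := k1 (by positivity)
    rwa [inv_mul_eq_div, le_div_iff₀ hn] at this
  · have := k2 (by positivity)
    exact (mul_pos_iff_of_pos_left (inv_pos.2 hn)).1 this

/-- The estimate behind the push-up property. Let `w` be causal and future-directed for `G`. When
the form changes to `G'`, by at most a small multiple `κ η` of `η`, adding `η` times the timelike
vector `V` keeps `w` causal and future-directed. -/
theorem cone_push {G G' : E →L[ℝ] E →L[ℝ] ℝ} (hsymm : ∀ v w, G v w = G w v) {V w : E}
    {a κ η W : ℝ} (ha : 0 < a) (hη : 0 < η) (hη1 : η ≤ 1) (hκ : 0 ≤ κ) (hW : ‖w‖ ≤ W)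
    (hdist : ‖G' - G‖ ≤ κ * η) (hκa : κ * (2 * W + 2 * ‖V‖ ^ 2 + ‖V‖ + 1) ≤ a)
    (hVV : a ≤ G V V) (hww : 0 ≤ G w w) (hVw : a * ‖w‖ ≤ G V w) :
    0 ≤ G' (w + η • V) (w + η • V) ∧ 0 < G' V (w + η • V) := by
  have hbd : ∀ v v' : E, |G' v v' - G v v'| ≤ κ * η * (‖v‖ * ‖v'‖) := fun v v' ↦ by
    have := (G' - G).le_opNorm₂ v v'
    rw [sub_apply, sub_apply, Real.norm_eq_abs, mul_assoc] at this
    exact this.trans (by gcongr)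
  have hnorm : ‖w + η • V‖ ≤ ‖w‖ + η * ‖V‖ := by
    simpa [norm_smul, abs_of_pos hη] using norm_add_le w (η • V)
  have hw0 := norm_nonneg w
  have hV0 := norm_nonneg V
  constructor
  · have h1 := (abs_le.1 (hbd (w + η • V) (w + η • V))).1
    have h2 : G (w + η • V) (w + η • V) = G w w + 2 * η * G V w + η ^ 2 * G V V := by
      simp [hsymm w V]; ring
    have h3 : ‖w + η • V‖ * ‖w + η • V‖ ≤ 2 * ‖w‖ ^ 2 + 2 * η ^ 2 * ‖V‖ ^ 2 := by
      nlinarith [norm_nonneg (w + η • V), sq_nonneg (‖w‖ - η * ‖V‖)]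
    have h4 : κ * η * (‖w + η • V‖ * ‖w + η • V‖) ≤
        κ * η * (2 * ‖w‖ ^ 2 + 2 * η ^ 2 * ‖V‖ ^ 2) := by gcongr
    have h5 : κ * (2 * W) ≤ a := le_trans (by gcongr; nlinarith) hκa
    have h6 : κ * (2 * ‖V‖ ^ 2) ≤ a := le_trans (by gcongr; nlinarith) hκa
    have h7 : κ * (2 * ‖w‖) ≤ a := le_trans (by gcongr) h5
    have h8 : κ * η * (2 * ‖w‖ ^ 2) ≤ η * (a * ‖w‖) := by
      calc _ = η * (κ * (2 * ‖w‖) * ‖w‖) := by ring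
        _ ≤ _ := by gcongr
    have h9 : κ * η * (2 * η ^ 2 * ‖V‖ ^ 2) ≤ η ^ 2 * a := by
      calc _ = η ^ 2 * (η * (κ * (2 * ‖V‖ ^ 2))) := by ring
        _ ≤ η ^ 2 * (1 * a) := by gcongr
        _ = _ := by ring
    have h10 : η * (a * ‖w‖) ≤ η * G V w := by gcongr
    have h11 : η ^ 2 * a ≤ η ^ 2 * G V V := by gcongr
    have h12 : 0 ≤ η * (a * ‖w‖) := by positivity
    nlinarith
  · have h1 := (abs_le.1 (hbd V (w + η • V))).1
    have h2 : G V (w + η • V) = G V w + η * G V V := by simp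
    have h4 : κ * η * (‖V‖ * ‖w + η • V‖) ≤ κ * η * (‖V‖ * (‖w‖ + η * ‖V‖)) := by gcongr
    have h6 : κ * (2 * ‖V‖ ^ 2 + 1) ≤ a := le_trans (by gcongr; nlinarith) hκa
    have h7 : κ * ‖V‖ ≤ a := le_trans (by gcongr; nlinarith) hκa
    have h8 : κ * η * (‖V‖ * ‖w‖) ≤ a * ‖w‖ := by
      calc _ = η * (κ * ‖V‖ * ‖w‖) := by ring
        _ ≤ 1 * (a * ‖w‖) := by gcongr
        _ = _ := by ring
    have h9 : κ * η * (‖V‖ * (η * ‖V‖)) ≤ η * (κ * ‖V‖ ^ 2) := by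
      calc _ = η * (η * (κ * ‖V‖ ^ 2)) := by ring
        _ ≤ η * (1 * (κ * ‖V‖ ^ 2)) := by gcongr
        _ = _ := by ring
    have h10 : κ * ‖V‖ ^ 2 < a := by
      rcases hκ.eq_or_lt with rfl | hκ
      · simpa using ha
      · nlinarith [mul_nonneg hκ.le (sq_nonneg ‖V‖)]
    have h11 : η * (κ * ‖V‖ ^ 2) < η * a := by gcongr
    have h12 : η * a ≤ η * G V V := by gcongr
    nlinarith

end Cone

/-! ### Timelike curves and the chronology relation -/

namespace Spacetime

variable {d : ℕ} {M : Type*} [TopologicalSpace M]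
  [ChartedSpace (EuclideanSpace ℝ (Fin d)) M] [IsManifold (𝓡 d) ∞ M] (S : Spacetime d M)

/-- In Lorentzian signature no nonzero causal vector is orthogonal to a timelike one. -/
theorem eq_zero_of_causal_of_orthogonal (x : M) {t w : TangentSpace (𝓡 d) x} (ht : 0 < S.g x t t)
    (hw : 0 ≤ S.g x w w) (htw : S.g x t w = 0) : w = 0 := by
  obtain ⟨v, hv, hneg⟩ := S.lorentzian x
  by_contra hw0
  -- this combination of `t` and `w` is orthogonal to `v`, but not negative
  have hu : S.g x v w • t - S.g x v t • w = 0 := by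
    by_contra hne
    have h1 := hneg _ hne (by simp; ring)
    have h2 : S.g x (S.g x v w • t - S.g x v t • w) (S.g x v w • t - S.g x v t • w) =
        S.g x v w ^ 2 * S.g x t t + S.g x v t ^ 2 * S.g x w w := by
      simp [S.symm x w t, htw]; ring
    rw [h2] at h1
    have := mul_nonneg (sq_nonneg (S.g x v w)) ht.le
    have := mul_nonneg (sq_nonneg (S.g x v t)) hw
    linarith
  have h3 : S.g x v w * S.g x t t = 0 := by
    have := congrArg (S.g x t) hu
    simpa [htw] using this
  have h4 : S.g x v w = 0 := (mul_eq_zero.1 h3).resolve_right ht.ne'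
  linarith [hneg w hw0 h4]

theorem chartMetric_chartTime_pos {x₀ : M} {u : EuclideanSpace ℝ (Fin d)}
    (hu : u ∈ (extChartAt (𝓡 d) x₀).target) :
    0 < S.chartMetric x₀ u (S.chartTime x₀ u) (S.chartTime x₀ u) := by
  rw [chartMetric_chartTime _ hu, chartTime,
    chartFrame_chartCoord ((extChartAt (𝓡 d) x₀).map_target hu)]
  exact S.T_timelike _

theorem chart_eq_zero_of_causal_of_orthogonal {x₀ : M} {u : EuclideanSpace ℝ (Fin d)}
    (hu : u ∈ (extChartAt (𝓡 d) x₀).target) (w : EuclideanSpace ℝ (Fin d))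
    (hw : 0 ≤ S.chartMetric x₀ u w w) (htw : S.chartMetric x₀ u (S.chartTime x₀ u) w = 0) :
    w = 0 := by
  rw [chartMetric_chartTime _ hu] at htw
  rw [← chartCoord_chartFrame ((extChartAt (𝓡 d) x₀).map_target hu) w,
    S.eq_zero_of_causal_of_orthogonal _ (S.T_timelike _) hw htw, map_zero]

theorem JplusPt_subset {x y : M} (h : y ∈ S.JplusPt x) : S.JplusPt y ⊆ S.JplusPt x :=
  fun _ hz ↦ Relation.ReflTransGen.trans h hz

theorem JminusPt_subset {x y : M} (h : y ∈ S.JminusPt x) : S.JminusPt y ⊆ S.JminusPt x :=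
  fun _ hz ↦ Relation.ReflTransGen.trans hz h

/-- The chronology relation in a topological form: `x` is an interior point of the causal past of
`y` and `y` an interior point of the causal future of `x`. End points of timelike curves are
related in this way. -/
def Chron (x y : M) : Prop :=
  x ∈ interior (S.JminusPt y) ∧ y ∈ interior (S.JplusPt x)

/-- Near `x₀`, and for directions near a future-directed timelike vector `v`, straight segments in
the chart are timelike. As the condition on the end points is open, these are
related by `Chron`. -/
theorem exists_chron_of_chart (x₀ : M) {v : EuclideanSpace ℝ (Fin d)}
    (hv : 0 < S.chartMetric x₀ (extChartAt (𝓡 d) x₀ x₀) v v)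
    (hτv : 0 < S.chartMetric x₀ (extChartAt (𝓡 d) x₀ x₀)
      (S.chartTime x₀ (extChartAt (𝓡 d) x₀ x₀)) v) :
    ∃ U ∈ 𝓝 (extChartAt (𝓡 d) x₀ x₀), ∃ W ∈ 𝓝 v, ∀ p ∈ U, ∀ q ∈ U,
      ∀ r : ℝ, 0 < r → r⁻¹ • (q - p) ∈ W →
        S.Chron ((extChartAt (𝓡 d) x₀).symm p) ((extChartAt (𝓡 d) x₀).symm q) := by
  set φ := extChartAt (𝓡 d) x₀
  set u₀ := φ x₀
  have htar : φ.target ∈ 𝓝 u₀ := extChartAt_target_mem_nhds x₀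
  have hG : ContinuousAt (S.chartMetric x₀) u₀ :=
    (S.contDiffOn_chartMetric x₀).continuousOn.continuousAt htar
  have hτ : ContinuousAt (S.chartTime x₀) u₀ := (S.continuousOn_chartTime x₀).continuousAt htar
  have e1 : ∀ᶠ z : _ × _ in 𝓝 u₀ ×ˢ 𝓝 v, 0 < S.chartMetric x₀ z.1 z.2 z.2 := by
    rw [← nhds_prod_eq]
    exact (((hG.comp (x := (u₀, v)) continuousAt_fst).clm_apply continuousAt_snd).clm_apply
      continuousAt_snd).eventually_const_lt hv
  have e2 : ∀ᶠ z : _ × _ in 𝓝 u₀ ×ˢ 𝓝 v, 0 < S.chartMetric x₀ z.1 (S.chartTime x₀ z.1) z.2 := by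
    rw [← nhds_prod_eq]
    exact (((hG.comp (x := (u₀, v)) continuousAt_fst).clm_apply
      (hτ.comp (x := (u₀, v)) continuousAt_fst)).clm_apply
      continuousAt_snd).eventually_const_lt hτv
  obtain ⟨P, hP, Q, hQ, hPQ⟩ := eventually_prod_iff.1 (e1.and e2)
  obtain ⟨ε, hε, hball⟩ := Metric.mem_nhds_iff.1 (inter_mem htar hP)
  have key : ∀ p ∈ Metric.ball u₀ ε, ∀ q ∈ Metric.ball u₀ ε, ∀ r : ℝ, 0 < r →
      r⁻¹ • (q - p) ∈ interior {w | Q w} → S.CausalStep (φ.symm p) (φ.symm q) := by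
    intro p hp q hq r hr hw
    have hw' : Q (r⁻¹ • (q - p)) := interior_subset hw
    set w := r⁻¹ • (q - p) with hwdef
    have hqp : q = p + r • w := by simp [hwdef, smul_smul, hr.ne']
    have hline : ∀ t ∈ Set.Icc 0 r, p + t • w ∈ Metric.ball u₀ ε := fun t ht ↦ by
      have : p + t • w = p + (t / r) • (q - p) := by
        rw [hwdef, smul_smul, div_eq_mul_inv]
      rw [this]
      exact (convex_ball u₀ ε).add_smul_sub_mem hp hq
        ⟨div_nonneg ht.1 hr.le, (div_le_one hr).2 ht.2⟩
    have hder : ∀ t ∈ Set.Icc 0 r, derivWithin (fun t : ℝ ↦ p + t • w) (Set.Icc 0 r) t = w :=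
      fun t ht ↦ by
        have : HasDerivAt (fun t : ℝ ↦ p + t • w) w t := by
          simpa using ((hasDerivAt_id t).smul_const w).const_add p
        exact this.hasDerivWithinAt.derivWithin (uniqueDiffOn_Icc hr t ht)
    have := S.causalStep_of_chart (x₀ := x₀) (c := fun t : ℝ ↦ p + t • w) hr
      (by fun_prop) (fun t ht ↦ (hball (hline t ht)).1) (fun t ht ↦ by
        rw [hder t ht]
        have := hPQ (hball (hline t ht)).2 hw'
        exact ⟨this.1.le, this.2⟩)
    simp only [zero_smul, add_zero, ← hqp] at this
    exact this
  refine ⟨_, Metric.ball_mem_nhds u₀ hε, interior {w | Q w}, interior_mem_nhds.2 hQ,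
    fun p hp q hq r hr hw ↦ ?_⟩
  have hbt : ∀ p ∈ Metric.ball u₀ ε, p ∈ φ.target := fun p hp ↦ (hball hp).1
  have hcont : ∀ p ∈ Metric.ball u₀ ε, Tendsto φ (𝓝 (φ.symm p)) (𝓝 p) := fun p hp ↦ by
    have := continuousAt_extChartAt' (I := 𝓡 d) (φ.map_target (hbt p hp))
    rw [ContinuousAt, φ.right_inv (hbt p hp)] at this
    exact this
  have hsrc : ∀ p ∈ Metric.ball u₀ ε, ∀ᶠ y in 𝓝 (φ.symm p), y ∈ φ.source := fun p hp ↦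
    extChartAt_source_mem_nhds' (φ.map_target (hbt p hp))
  constructor
  · rw [mem_interior_iff_mem_nhds]
    filter_upwards [hsrc p hp, (hcont p hp).eventually (Metric.isOpen_ball.mem_nhds hp),
      (hcont p hp).eventually
        (((continuous_const.sub continuous_id).const_smul r⁻¹).continuousAt.eventually
        (isOpen_interior.mem_nhds hw))] with y h1 h2 h3
    have := key _ h2 q hq r hr h3
    rw [φ.left_inv h1] at this
    exact Relation.ReflTransGen.single this
  · rw [mem_interior_iff_mem_nhds]
    filter_upwards [hsrc q hq, (hcont q hq).eventually (Metric.isOpen_ball.mem_nhds hq),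
      (hcont q hq).eventually
        (((continuous_id.sub continuous_const).const_smul r⁻¹).continuousAt.eventually
        (isOpen_interior.mem_nhds hw))] with y h1 h2 h3
    have := key p hp _ h2 r hr h3
    rw [φ.left_inv h1] at this
    exact Relation.ReflTransGen.single this

theorem Chron.trans_mem_left {S : Spacetime d M} {x y z : M} (h : S.Chron y z)
    (hxy : y ∈ S.JplusPt x) :
    z ∈ interior (S.JplusPt x) :=
  interior_mono (S.JplusPt_subset hxy) h.2

theorem Chron.trans_mem_right {S : Spacetime d M} {x y z : M} (h : S.Chron x y)
    (hyz : z ∈ S.JplusPt y) :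
    x ∈ interior (S.JminusPt z) :=
  interior_mono (S.JminusPt_subset (y := y) (x := z) hyz) h.1

theorem IsCausalSegment.mem_JplusPt {S : Spacetime d M} {γ : ℝ → M} {a b s t : ℝ}
    (h : S.IsCausalSegment γ a b) (hs : a ≤ s) (hst : s ≤ t) (ht : t ≤ b) :
    γ t ∈ S.JplusPt (γ s) := by
  rcases hst.eq_or_lt with rfl | hst
  · exact Relation.ReflTransGen.refl
  · exact Relation.ReflTransGen.single ⟨γ, s, t, h.mono hs hst ht, rfl, rfl⟩

theorem IsTimelikeSegment.eventually_chron {S : Spacetime d M} {γ : ℝ → M} {a b t : ℝ}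
    (h : S.IsTimelikeSegment γ a b) (ht : t ∈ Set.Icc a b) : ∀ᶠ s in 𝓝[Set.Icc a b \ {t}] t,
      (s < t → S.Chron (γ s) (γ t)) ∧ (t < s → S.Chron (γ t) (γ s)) := by
  set φ := extChartAt (𝓡 d) (γ t) with hφ
  have hsrc : γ t ∈ φ.source := mem_extChartAt_source _
  have hv := chartFrame_derivWithin h.1 h.2.1 ht hsrc
  have htl := h.2.2 t ht
  rw [FutureTimelike, ← hv, ← chartMetric_extChartAt _ hsrc,
    ← chartMetric_chartTime_extChartAt _ hsrc] at htl
  obtain ⟨U, hU, W, hW, key⟩ := S.exists_chron_of_chart (γ t) htl.1 htl.2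
  have hd := (hasDerivWithinAt_chart h.2.1 ht hsrc)
  have hcont : ContinuousWithinAt γ (Set.Icc a b \ {t}) t :=
    (h.2.1.continuousOn t ht).mono Set.sdiff_subset
  have e1 := (hasDerivWithinAt_iff_tendsto_slope.1 hd).eventually hW
  have e2 := (hd.continuousWithinAt.mono (Set.sdiff_subset (t := {t}))).eventually hU
  have e3 := hcont.eventually ((isOpen_extChartAt_source (I := 𝓡 d) (γ t)).mem_nhds hsrc)
  filter_upwards [e1, e2, e3] with s h1 h2 h3
  refine ⟨fun hst ↦ ?_, fun hst ↦ ?_⟩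
  · have := key _ h2 _ (mem_of_mem_nhds hU) (t - s) (by linarith)
      (by rwa [slope_comm, slope_def_module] at h1)
    rwa [φ.left_inv h3, φ.left_inv hsrc] at this
  · have := key _ (mem_of_mem_nhds hU) _ h2 (s - t) (by linarith)
      (by rwa [slope_def_module] at h1)
    rwa [φ.left_inv h3, φ.left_inv hsrc] at this

theorem IsTimelikeSegment.chron {S : Spacetime d M} {γ : ℝ → M} {a b : ℝ}
    (h : S.IsTimelikeSegment γ a b) :
    S.Chron (γ a) (γ b) := by
  have hab := h.1
  have hc := h.isCausalSegment
  constructor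
  · have e := h.eventually_chron ⟨le_rfl, hab.le⟩
    rw [show Set.Icc a b \ {a} = Set.Ioc a b from Set.Icc_sdiff_left] at e
    have : (𝓝[Set.Ioc a b] a).NeBot := left_nhdsWithin_Ioc_neBot hab
    obtain ⟨s, h1, h2⟩ := (e.and self_mem_nhdsWithin).exists
    exact (h1.2 h2.1).trans_mem_right (hc.mem_JplusPt h2.1.le h2.2 le_rfl)
  · have e := h.eventually_chron ⟨hab.le, le_rfl⟩
    rw [show Set.Icc a b \ {b} = Set.Ico a b from Set.Icc_sdiff_right] at e
    have : (𝓝[Set.Ico a b] b).NeBot := right_nhdsWithin_Ico_neBot hab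
    obtain ⟨s, h1, h2⟩ := (e.and self_mem_nhdsWithin).exists
    exact (h1.1 h2.2).trans_mem_left (hc.mem_JplusPt le_rfl h2.1 h2.2.le)

/-- Near `x₀`, moving along the constant vector field of the chart that agrees with the time
orientation at `x₀` leads into the chronological future. -/
theorem exists_chron_add_smul_time (x₀ : M) :
    ∃ U ∈ 𝓝 (extChartAt (𝓡 d) x₀ x₀), ∀ p ∈ U, ∀ r : ℝ, 0 < r →
      p + r • S.chartTime x₀ (extChartAt (𝓡 d) x₀ x₀) ∈ U →
      S.Chron ((extChartAt (𝓡 d) x₀).symm p)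
        ((extChartAt (𝓡 d) x₀).symm (p + r • S.chartTime x₀ (extChartAt (𝓡 d) x₀ x₀))) := by
  have hpos := S.chartMetric_chartTime_pos (mem_extChartAt_target (I := 𝓡 d) x₀)
  obtain ⟨U, hU, W, hW, key⟩ := S.exists_chron_of_chart x₀ hpos hpos
  refine ⟨U, hU, fun p hp r hr hq ↦ key p hp _ hq r hr ?_⟩
  simpa [smul_smul, hr.ne'] using mem_of_mem_nhds hW

theorem mem_closure_chron_right (x : M) : x ∈ closure {y | S.Chron x y} := by
  obtain ⟨U, hU, key⟩ := S.exists_chron_add_smul_time x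
  set φ := extChartAt (𝓡 d) x
  set V := S.chartTime x (φ x)
  have ht : Tendsto (fun r : ℝ ↦ φ x + r • V) (𝓝[>] 0) (𝓝 (φ x)) := by
    have : Continuous fun r : ℝ ↦ φ x + r • V := by fun_prop
    have := this.tendsto 0
    rw [zero_smul, add_zero] at this
    exact this.mono_left nhdsWithin_le_nhds
  have ht2 : Tendsto (fun r : ℝ ↦ φ.symm (φ x + r • V)) (𝓝[>] 0) (𝓝 x) := by
    have := (continuousAt_extChartAt_symm (I := 𝓡 d) x).tendsto.comp ht
    rwa [extChartAt_to_inv] at this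
  refine mem_closure_of_tendsto ht2 ?_
  filter_upwards [ht.eventually hU, self_mem_nhdsWithin] with r h1 h2
  have := key _ (mem_of_mem_nhds hU) r h2 h1
  rwa [extChartAt_to_inv] at this

theorem mem_closure_chron_left (x : M) : x ∈ closure {y | S.Chron y x} := by
  obtain ⟨U, hU, key⟩ := S.exists_chron_add_smul_time x
  set φ := extChartAt (𝓡 d) x
  set V := S.chartTime x (φ x)
  have ht : Tendsto (fun r : ℝ ↦ φ x - r • V) (𝓝[>] 0) (𝓝 (φ x)) := by
    have : Continuous fun r : ℝ ↦ φ x - r • V := by fun_prop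
    have := this.tendsto 0
    rw [zero_smul, sub_zero] at this
    exact this.mono_left nhdsWithin_le_nhds
  have ht2 : Tendsto (fun r : ℝ ↦ φ.symm (φ x - r • V)) (𝓝[>] 0) (𝓝 x) := by
    have := (continuousAt_extChartAt_symm (I := 𝓡 d) x).tendsto.comp ht
    rwa [extChartAt_to_inv] at this
  refine mem_closure_of_tendsto ht2 ?_
  filter_upwards [ht.eventually hU, self_mem_nhdsWithin] with r h1 h2
  have := key _ h1 r h2 (by simpa using mem_of_mem_nhds hU)
  rw [sub_add_cancel, extChartAt_to_inv] at this
  exact this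

end Spacetime

/-! ### The push-up property -/

namespace Spacetime

variable {d : ℕ} {M : Type*} [TopologicalSpace M]
  [ChartedSpace (EuclideanSpace ℝ (Fin d)) M] [IsManifold (𝓡 d) ∞ M] (S : Spacetime d M)

/-- Pushing a causal curve off itself in a chart. Near `x₀`, a causal segment `γ` stays causal
when `f V` is added to it, `V` being the time orientation at `x₀`, as long as `f` is small with
small derivative `f' ≥ l |f|`, where the rate `l` depends on `γ`. -/
theorem exists_pushed_causalStep (x₀ : M) :
    ∃ ε > 0, Metric.ball (extChartAt (𝓡 d) x₀ x₀) ε ⊆ (extChartAt (𝓡 d) x₀).target ∧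
      ∀ (γ : ℝ → M) (s t : ℝ), S.IsCausalSegment γ s t →
      (∀ r ∈ Set.Icc s t, γ r ∈ (extChartAt (𝓡 d) x₀).source) →
      (∀ r ∈ Set.Icc s t, extChartAt (𝓡 d) x₀ (γ r) ∈ Metric.ball (extChartAt (𝓡 d) x₀ x₀) ε) →
      ∃ l > 0, ∀ f f' : ℝ → ℝ, (∀ r, HasDerivAt f (f' r) r) → Continuous f' →
      (∀ r ∈ Set.Icc s t, 0 < f' r ∧ f' r ≤ 1 ∧ l * |f r| ≤ f' r ∧
        extChartAt (𝓡 d) x₀ (γ r) + f r • S.chartTime x₀ (extChartAt (𝓡 d) x₀ x₀) ∈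
          Metric.ball (extChartAt (𝓡 d) x₀ x₀) ε) →
      S.CausalStep
        ((extChartAt (𝓡 d) x₀).symm (extChartAt (𝓡 d) x₀ (γ s) +
          f s • S.chartTime x₀ (extChartAt (𝓡 d) x₀ x₀)))
        ((extChartAt (𝓡 d) x₀).symm (extChartAt (𝓡 d) x₀ (γ t) +
          f t • S.chartTime x₀ (extChartAt (𝓡 d) x₀ x₀))) := by
  set φ := extChartAt (𝓡 d) x₀
  set u₀ := φ x₀
  set V := S.chartTime x₀ u₀
  have htar : φ.target ∈ 𝓝 u₀ := extChartAt_target_mem_nhds x₀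
  have hu₀ : u₀ ∈ φ.target := mem_of_mem_nhds htar
  have hGd : ContDiffAt ℝ 1 (S.chartMetric x₀) u₀ := (S.contDiffOn_chartMetric x₀).contDiffAt htar
  have hτ : ContinuousAt (S.chartTime x₀) u₀ := (S.continuousOn_chartTime x₀).continuousAt htar
  obtain ⟨a₁, ha₁, hcone⟩ := exists_uniform_cone_bound hGd.continuousAt hτ
    (fun w ↦ S.chart_eq_zero_of_causal_of_orthogonal hu₀ w)
  obtain ⟨L, N, hN, hL⟩ := hGd.exists_lipschitzOnWith
  have hVpos : 0 < S.chartMetric x₀ u₀ V V := S.chartMetric_chartTime_pos hu₀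
  obtain ⟨a, ha, haa₁, haV⟩ : ∃ a > 0, a ≤ a₁ ∧ a < S.chartMetric x₀ u₀ V V :=
    ⟨min a₁ (S.chartMetric x₀ u₀ V V / 2), by positivity, min_le_left _ _,
      (min_le_right _ _).trans_lt (by linarith)⟩
  have hVV : ∀ᶠ u in 𝓝 u₀, a < S.chartMetric x₀ u V V :=
    ((hGd.continuousAt.clm_apply continuousAt_const).clm_apply
      continuousAt_const).eventually_const_lt haV
  obtain ⟨ε, hε, hball⟩ := Metric.eventually_nhds_iff_ball.1
    (hcone.and (hVV.and ((eventually_mem_nhds_iff.2 htar).and (eventually_mem_nhds_iff.2 hN))))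
  have htarg : ∀ u ∈ Metric.ball u₀ ε, u ∈ φ.target := fun u hu ↦
    mem_of_mem_nhds (hball u hu).2.2.1
  refine ⟨ε, hε, htarg, fun γ s t hγ hsrc hmem ↦ ?_⟩
  set c : ℝ → EuclideanSpace ℝ (Fin d) := fun r ↦ φ (γ r) with hc
  have hcd : ContDiffOn ℝ 1 c (Set.Icc s t) := contDiffOn_chart hγ.2.1 hsrc
  have hst := hγ.1
  set c' := derivWithin c (Set.Icc s t)
  have hc' : ContinuousOn c' (Set.Icc s t) :=
    hcd.continuousOn_derivWithin (uniqueDiffOn_Icc hst) le_rfl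
  obtain ⟨B, hB⟩ := isCompact_Icc.exists_bound_of_continuousOn hc'
  have hB0 : 0 ≤ B := (norm_nonneg _).trans (hB s ⟨le_rfl, hst.le⟩)
  have hV0 := norm_nonneg V
  set D := 2 * B + 2 * ‖V‖ ^ 2 + ‖V‖ + 1 with hD
  have hDpos : 0 < D := by positivity
  -- the rate `l` makes the gain `f'` in the cone outweigh the change `L ‖f V‖` of the metric
  refine ⟨(L * ‖V‖ + 1) * D / a, by positivity, fun f f' hf hf' hprop ↦ ?_⟩
  set l := (L * ‖V‖ + 1) * D / a with hl
  have hlpos : 0 < l := by positivity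
  have hder : ∀ r ∈ Set.Icc s t,
      derivWithin (fun r ↦ c r + f r • V) (Set.Icc s t) r = c' r + f' r • V := fun r hr ↦ by
    have h1 : HasDerivWithinAt c (c' r) (Set.Icc s t) r :=
      (hcd.differentiableOn one_ne_zero r hr).hasDerivWithinAt
    exact (h1.add ((hf r).hasDerivWithinAt.smul_const V)).derivWithin (uniqueDiffOn_Icc hst r hr)
  have hfd : ContDiff ℝ 1 f := by
    rw [contDiff_one_iff_deriv]
    refine ⟨fun r ↦ (hf r).differentiableAt, ?_⟩
    rwa [show deriv f = f' from funext fun r ↦ (hf r).deriv]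
  refine S.causalStep_of_chart (c := fun r ↦ c r + f r • V) hst
    (hcd.add (hfd.smul contDiff_const).contDiffOn) (fun r hr ↦ htarg _ (hprop r hr).2.2.2) ?_
  intro r hr
  rw [hder r hr]
  obtain ⟨h1, h2, h3, h4⟩ := hprop r hr
  obtain ⟨k1, k2, -, k3⟩ := hball _ (hmem r hr)
  obtain ⟨k1', k2', -, k3'⟩ := hball _ h4
  have hfc := hγ.2.2 r hr
  rw [FutureCausal, ← chartFrame_derivWithin hst hγ.2.1 hr (hsrc r hr),
    ← chartMetric_extChartAt _ (hsrc r hr), ← chartMetric_chartTime_extChartAt _ (hsrc r hr)] at hfc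
  have hVw := (k1 _ hfc.1).1 hfc.2
  have hdist : ‖S.chartMetric x₀ (c r + f r • V) - S.chartMetric x₀ (c r)‖ ≤
      (L * ‖V‖ / l) * f' r := by
    have := hL.dist_le_mul _ (mem_of_mem_nhds k3') _ (mem_of_mem_nhds k3)
    rw [dist_eq_norm, dist_eq_norm, add_sub_cancel_left, norm_smul, Real.norm_eq_abs] at this
    refine this.trans ?_
    have h5 : |f r| ≤ f' r / l := by rw [le_div_iff₀ hlpos]; linarith
    calc L * (|f r| * ‖V‖) ≤ L * (f' r / l * ‖V‖) := by gcongr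
      _ = _ := by ring
  have hkap : (L * ‖V‖ / l) * D ≤ a := by
    rw [hl, div_mul_eq_mul_div, div_le_iff₀ (by positivity)]
    have : a * ((L * ‖V‖ + 1) * D / a) = (L * ‖V‖ + 1) * D := by field_simp
    rw [this]
    gcongr
    linarith
  obtain ⟨m1, m2⟩ := cone_push (fun v w ↦ S.chartMetric_symm x₀ _ v w) (V := V) ha h1 h2
    (by positivity) (hB r hr) hdist hkap k2.le hfc.1
    (le_trans (by gcongr) hVw)
  exact ⟨m1, (k1' _ m1).2 m2⟩

/-- The local push-up property: a causal segment near `x₀` that ends in the interior of the causal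
past of `z` starts there as well, and dually. -/
theorem exists_nhds_push_up (x₀ : M) : ∃ N ∈ 𝓝 x₀, ∀ (γ : ℝ → M) (s t : ℝ),
    S.IsCausalSegment γ s t → (∀ r ∈ Set.Icc s t, γ r ∈ N) → ∀ z,
    (γ t ∈ interior (S.JminusPt z) → γ s ∈ interior (S.JminusPt z)) ∧
    (γ s ∈ interior (S.JplusPt z) → γ t ∈ interior (S.JplusPt z)) := by
  obtain ⟨ε, hε, -, hpush⟩ := S.exists_pushed_causalStep x₀
  obtain ⟨U, hU, hchron⟩ := S.exists_chron_add_smul_time x₀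
  obtain ⟨ρ, hρ, hρU⟩ := Metric.mem_nhds_iff.1 hU
  set φ := extChartAt (𝓡 d) x₀
  set u₀ := φ x₀
  set V := S.chartTime x₀ u₀
  set μ := min (ε / 2) (ρ / 2) with hμ
  have hμ0 : 0 < μ := by positivity
  have hμε : μ + μ ≤ ε := by linarith [min_le_left (ε / 2) (ρ / 2)]
  have hμρ : μ + μ ≤ ρ := by linarith [min_le_right (ε / 2) (ρ / 2)]
  refine ⟨φ.source ∩ φ ⁻¹' Metric.ball u₀ μ,
    inter_mem (extChartAt_source_mem_nhds x₀)
      (continuousAt_extChartAt x₀ (Metric.ball_mem_nhds u₀ hμ0)), fun γ s t hγ hN z ↦ ?_⟩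
  have hst := hγ.1
  have hsmem : s ∈ Set.Icc s t := ⟨le_rfl, hst.le⟩
  have htmem : t ∈ Set.Icc s t := ⟨hst.le, le_rfl⟩
  obtain ⟨l, hl, key⟩ := hpush γ s t hγ (fun r hr ↦ (hN r hr).1)
    (fun r hr ↦ Metric.ball_subset_ball (by linarith) (hN r hr).2)
  have hmove : ∀ r ∈ Set.Icc s t, ∀ e : ℝ, |e| * ‖V‖ < μ →
      φ (γ r) + e • V ∈ Metric.ball u₀ (μ + μ) := by
    intro r hr e he
    have h1 := (hN r hr).2
    rw [Set.mem_preimage, mem_ball_iff_norm] at h1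
    rw [mem_ball_iff_norm, add_sub_right_comm]
    refine (norm_add_le _ _).trans_lt (add_lt_add h1 ?_)
    rwa [norm_smul, Real.norm_eq_abs]
  have hsmall : ∀ᶠ e : ℝ in 𝓝[>] 0, 0 < e ∧ l * e ≤ 1 ∧ e * ‖V‖ < μ := by
    have h1 : Tendsto (fun e : ℝ ↦ l * e) (𝓝[>] 0) (𝓝 0) := by
      have : Continuous fun e : ℝ ↦ l * e := by fun_prop
      have := this.tendsto 0
      rw [mul_zero] at this
      exact this.mono_left nhdsWithin_le_nhds
    have h2 : Tendsto (fun e : ℝ ↦ e * ‖V‖) (𝓝[>] 0) (𝓝 0) := by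
      have : Continuous fun e : ℝ ↦ e * ‖V‖ := by fun_prop
      have := this.tendsto 0
      rw [zero_mul] at this
      exact this.mono_left nhdsWithin_le_nhds
    filter_upwards [self_mem_nhdsWithin, h1.eventually_lt_const one_pos, h2.eventually_lt_const hμ0]
      with e h1 h2 h3 using ⟨h1, h2.le, h3⟩
  constructor
  · -- the segment is pushed to the future by `e exp (l (r - t))`: its end point moves so little
    -- that it remains in the past of `z`, and its initial point lies in the future of `γ s`
    intro hz
    have h3 := (tendsto_chart_symm_add_smul (hN t htmem).1 V).mono_left
      (nhdsWithin_le_nhds (s := Set.Ioi 0)) |>.eventually (isOpen_interior.mem_nhds hz)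
    obtain ⟨e, ⟨he0, hel, heμ⟩, hez⟩ := (hsmall.and h3).exists
    have hf : ∀ r ∈ Set.Icc s t, |e * Real.exp (l * (r - t))| ≤ e := fun r hr ↦ by
      rw [abs_of_pos (by positivity)]
      exact mul_le_of_le_one_right he0.le
        (Real.exp_le_one_iff.2 (mul_nonpos_of_nonneg_of_nonpos hl.le (by linarith [hr.2])))
    have hfμ : ∀ r ∈ Set.Icc s t, |e * Real.exp (l * (r - t))| * ‖V‖ < μ := fun r hr ↦
      lt_of_le_of_lt (by gcongr; exact hf r hr) heμ
    have hstep := key (fun r ↦ e * Real.exp (l * (r - t)))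
      (fun r ↦ l * (e * Real.exp (l * (r - t))))
      (fun r ↦ by
        convert! ((((hasDerivAt_id r).sub_const t).const_mul l).exp).const_mul e using 1
        simp only [id]; ring)
      (by fun_prop) (fun r hr ↦ ⟨by positivity,
        (mul_le_mul_of_nonneg_left ((le_abs_self _).trans (hf r hr)) hl.le).trans hel,
        by rw [abs_of_pos (by positivity)],
        Metric.ball_subset_ball hμε (hmove r hr _ (hfμ r hr))⟩)
    have hch := hchron (φ (γ s)) (hρU (Metric.ball_subset_ball (by linarith) (hN s hsmem).2))
      (e * Real.exp (l * (s - t))) (by positivity)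
      (hρU (Metric.ball_subset_ball hμρ (hmove s hsmem _ (hfμ s hsmem))))
    rw [φ.left_inv (hN s hsmem).1] at hch
    refine hch.trans_mem_right
      (Relation.ReflTransGen.trans (Relation.ReflTransGen.single hstep) ?_)
    rw [sub_self, mul_zero, Real.exp_zero, mul_one]
    exact interior_subset (s := S.JminusPt z) hez
  · -- dually, the segment is pushed to the past by `e exp (l (s - r))`
    intro hz
    have h3 := (tendsto_chart_symm_add_smul (hN s hsmem).1 (-V)).mono_left
      (nhdsWithin_le_nhds (s := Set.Ioi 0)) |>.eventually (isOpen_interior.mem_nhds hz)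
    obtain ⟨e, ⟨he0, hel, heμ⟩, hez⟩ := (hsmall.and h3).exists
    have hf : ∀ r ∈ Set.Icc s t, |-(e * Real.exp (l * (s - r)))| ≤ e := fun r hr ↦ by
      rw [abs_neg, abs_of_pos (by positivity)]
      exact mul_le_of_le_one_right he0.le
        (Real.exp_le_one_iff.2 (mul_nonpos_of_nonneg_of_nonpos hl.le (by linarith [hr.1])))
    have hfμ : ∀ r ∈ Set.Icc s t, |-(e * Real.exp (l * (s - r)))| * ‖V‖ < μ := fun r hr ↦
      lt_of_le_of_lt (by gcongr; exact hf r hr) heμ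
    have hstep := key (fun r ↦ -(e * Real.exp (l * (s - r))))
      (fun r ↦ l * (e * Real.exp (l * (s - r))))
      (fun r ↦ by
        convert! (((((hasDerivAt_id r).const_sub s).const_mul l).exp).const_mul e).neg using 1
        simp only [id]; ring)
      (by fun_prop) (fun r hr ↦ ⟨by positivity,
        (mul_le_mul_of_nonneg_left ((le_abs_self _).trans ((abs_neg _).symm.trans_le (hf r hr)))
          hl.le).trans hel,
        by rw [abs_neg, abs_of_pos (by positivity)],
        Metric.ball_subset_ball hμε (hmove r hr _ (hfμ r hr))⟩)
    have hch := hchron (φ (γ t) + (-(e * Real.exp (l * (s - t)))) • V)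
      (hρU (Metric.ball_subset_ball hμρ (hmove t htmem _ (hfμ t htmem))))
      (e * Real.exp (l * (s - t))) (by positivity)
      (by
        rw [neg_smul, neg_add_cancel_right]
        exact hρU (Metric.ball_subset_ball (by linarith) (hN t htmem).2))
    rw [neg_smul, neg_add_cancel_right, φ.left_inv (hN t htmem).1, ← neg_smul] at hch
    refine hch.trans_mem_left
      (Relation.ReflTransGen.trans ?_ (Relation.ReflTransGen.single hstep))
    rw [sub_self, mul_zero, Real.exp_zero, mul_one, neg_smul, ← smul_neg]
    exact interior_subset (s := S.JplusPt z) hez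

theorem CausalStep.mem_interior_JminusPt {S : Spacetime d M} {x y z : M}
    (h : S.CausalStep x y) (hy : y ∈ interior (S.JminusPt z)) : x ∈ interior (S.JminusPt z) := by
  obtain ⟨γ, a, b, hγ, rfl, rfl⟩ := h
  have hab := hγ.1
  by_contra hx
  -- the parameters at which the curve is outside of the open set propagate to the future
  have hcl : IsClosed ({t | γ t ∉ interior (S.JminusPt z)} ∩ Set.Icc a b) := by
    rw [Set.inter_comm]
    exact hγ.2.1.continuousOn.preimage_isClosed_of_isClosed isClosed_Icc
      isOpen_interior.isClosed_compl
  refine hcl.Icc_subset_of_forall_exists_gt hx (fun t ht y hy ↦ ?_) ⟨hab.le, le_rfl⟩ hy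
  obtain ⟨N, hN, key⟩ := S.exists_nhds_push_up (γ t)
  have h1 : ∀ᶠ r in 𝓝[Set.Icc a b] t, γ r ∈ N := hγ.2.1.continuousOn t ⟨ht.2.1, ht.2.2.le⟩ hN
  rw [eventually_nhdsWithin_iff, Metric.eventually_nhds_iff] at h1
  obtain ⟨ε, hε, hball⟩ := h1
  obtain ⟨t', htt', ht'⟩ := exists_between (lt_min (lt_min hy ht.2.2) (show t < t + ε by linarith))
  have hy' : t' < y := ht'.trans_le ((min_le_left _ _).trans (min_le_left _ _))
  have hb' : t' < b := ht'.trans_le ((min_le_left _ _).trans (min_le_right _ _))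
  have hε' : t' < t + ε := ht'.trans_le (min_le_right _ _)
  refine ⟨t', fun hmem ↦ ht.1 ?_, htt', hy'.le⟩
  refine (key γ t t' (hγ.mono ht.2.1 htt' hb'.le) (fun r hr ↦ hball ?_
    ⟨ht.2.1.trans hr.1, hr.2.trans hb'.le⟩) z).1 hmem
  rw [Real.dist_eq, abs_of_nonneg (by linarith [hr.1])]
  linarith [hr.2]

theorem CausalStep.mem_interior_JplusPt {S : Spacetime d M} {x y z : M}
    (h : S.CausalStep x y) (hx : x ∈ interior (S.JplusPt z)) : y ∈ interior (S.JplusPt z) := by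
  obtain ⟨γ, a, b, hγ, rfl, rfl⟩ := h
  have hab := hγ.1
  by_contra hy
  have hcl : IsClosed ({t | γ t ∉ interior (S.JplusPt z)} ∩ Set.Icc a b) := by
    rw [Set.inter_comm]
    exact hγ.2.1.continuousOn.preimage_isClosed_of_isClosed isClosed_Icc
      isOpen_interior.isClosed_compl
  refine hcl.Icc_subset_of_forall_exists_lt hy (fun t ht y hy ↦ ?_) ⟨le_rfl, hab.le⟩ hx
  obtain ⟨N, hN, key⟩ := S.exists_nhds_push_up (γ t)
  have h1 : ∀ᶠ r in 𝓝[Set.Icc a b] t, γ r ∈ N := hγ.2.1.continuousOn t ⟨ht.2.1.le, ht.2.2⟩ hN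
  rw [eventually_nhdsWithin_iff, Metric.eventually_nhds_iff] at h1
  obtain ⟨ε, hε, hball⟩ := h1
  obtain ⟨t', ht', htt'⟩ := exists_between (max_lt (max_lt hy ht.2.1) (show t - ε < t by linarith))
  have hy' : y < t' := ((le_max_left _ _).trans (le_max_left _ _)).trans_lt ht'
  have hb' : a < t' := ((le_max_right _ _).trans (le_max_left _ _)).trans_lt ht'
  have hε' : t - ε < t' := (le_max_right _ _).trans_lt ht'
  refine ⟨t', fun hmem ↦ ht.1 ?_, hy'.le, htt'⟩
  refine (key γ t' t (hγ.mono hb'.le htt' ht.2.2) (fun r hr ↦ hball ?_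
    ⟨hb'.le.trans hr.1, hr.2.trans ht.2.2⟩) z).2 hmem
  rw [Real.dist_eq, abs_of_nonpos (by linarith [hr.2])]
  linarith [hr.1]

end Spacetime

/-! ### Order theory of globally hyperbolic spacetimes -/

/-- The properties of the causal relation `R` of a globally hyperbolic spacetime that enter the
construction of Cauchy surfaces. They are symmetric under time reversal. -/
structure IsGloballyHyperbolicOrder {M : Type*} [TopologicalSpace M] (R : M → M → Prop) :
    Prop where
  refl (x : M) : R x x
  trans {x y z : M} : R x y → R y z → R x z
  antisymm {x y : M} : R x y → R y x → x = y
  /-- causal diamonds are compact -/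
  isCompact (x y : M) : IsCompact {z | R x z ∧ R z y}
  /-- every point is a limit of points of its chronological future -/
  mem_closure_right (x : M) : x ∈ closure {y | x ∈ interior {z | R z y}}
  /-- every point is a limit of points of its chronological past -/
  mem_closure_left (x : M) : x ∈ closure {y | x ∈ interior {z | R y z}}
  /-- the interior of the causal past of a point is a past set -/
  push_left {x y z : M} : R x y → y ∈ interior {w | R w z} → x ∈ interior {w | R w z}
  /-- the interior of the causal future of a point is a future set -/
  push_right {x y z : M} : R x y → x ∈ interior {w | R z w} → y ∈ interior {w | R z w}

namespace IsGloballyHyperbolicOrder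

variable {M : Type*} [TopologicalSpace M] {R : M → M → Prop}

theorem flip (h : IsGloballyHyperbolicOrder R) : IsGloballyHyperbolicOrder fun x y ↦ R y x where
  refl := h.refl
  trans := fun h1 h2 ↦ h.trans h2 h1
  antisymm := fun h1 h2 ↦ h.antisymm h2 h1
  isCompact := fun x y ↦ by simpa only [and_comm] using h.isCompact y x
  mem_closure_right := h.mem_closure_left
  mem_closure_left := h.mem_closure_right
  push_left := h.push_right
  push_right := h.push_left

theorem exists_mem_interior (h : IsGloballyHyperbolicOrder R) (x : M) :
    ∃ y, x ∈ interior {z | R z y} :=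
  closure_nonempty_iff.1 ⟨x, h.mem_closure_right x⟩

theorem isClosed_above [T2Space M] (h : IsGloballyHyperbolicOrder R) (x : M) :
    IsClosed {y | R x y} := by
  refine isClosed_of_closure_subset fun y hy ↦ ?_
  obtain ⟨z, hz⟩ := h.exists_mem_interior y
  have h1 : y ∈ closure ({w | R w z} ∩ {y | R x y}) := by
    rw [mem_closure_iff_nhds]
    intro t ht
    obtain ⟨w, hw1, hw2⟩ := mem_closure_iff_nhds.1 hy _
      (inter_mem ht (mem_interior_iff_mem_nhds.1 hz))
    exact ⟨w, hw1.1, hw1.2, hw2⟩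
  have h2 := h.isCompact x z
  rw [show {w | R w z} ∩ {y | R x y} = {w | R x w ∧ R w z} by ext; simp [and_comm],
    h2.isClosed.closure_eq] at h1
  exact h1.1

theorem isClosed_below [T2Space M] (h : IsGloballyHyperbolicOrder R) (x : M) :
    IsClosed {y | R y x} :=
  h.flip.isClosed_above x

theorem isClosed_rel [T2Space M] (h : IsGloballyHyperbolicOrder R) :
    IsClosed {p : M × M | R p.1 p.2} := by
  refine isClosed_of_closure_subset fun ⟨x, y⟩ hxy ↦ ?_
  have h1 : ∀ p, x ∈ interior {z | R p z} → ∀ q, y ∈ interior {z | R z q} → R p q := by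
    intro p hp q hq
    obtain ⟨⟨x', y'⟩, hw1, hw2⟩ := mem_closure_iff_nhds.1 hxy _
      (prod_mem_nhds (mem_interior_iff_mem_nhds.1 hp) (mem_interior_iff_mem_nhds.1 hq))
    exact h.trans hw1.1 (h.trans hw2 hw1.2)
  have h2 : ∀ p, x ∈ interior {z | R p z} → R p y := fun p hp ↦
    closure_minimal (fun q hq ↦ h1 p hp q hq) (h.isClosed_above p) (h.mem_closure_right y)
  exact closure_minimal (fun p hp ↦ h2 p hp) (h.isClosed_below y) (h.mem_closure_left x)

theorem isClosed_below_of_isCompact [T2Space M] (h : IsGloballyHyperbolicOrder R) {K : Set M}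
    (hK : IsCompact K) : IsClosed {x | ∃ k ∈ K, R x k} := by
  refine isClosed_of_closure_subset fun x hx ↦ ?_
  by_contra hne
  have hnhds : ∀ᶠ y in 𝓝 x, ∀ k ∈ K, ¬ R y k :=
    hK.eventually_forall_of_forall_eventually fun k hk ↦
      h.isClosed_rel.isOpen_compl.mem_nhds fun hR ↦ hne ⟨k, hk, hR⟩
  obtain ⟨y, hy, k, hk, hyk⟩ := mem_closure_iff_nhds.1 hx _ hnhds
  exact hy k hk hyk

/-- A monotone curve without a future end point leaves the past of every point: otherwise it would
stay in a compact causal diamond, and monotonicity leaves room for only one cluster point. -/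
theorem eventually_not_rel [T2Space M] (h : IsGloballyHyperbolicOrder R) {γ : ℝ → M}
    (hmono : ∀ s t, s ≤ t → R (γ s) (γ t)) (hγ : ¬ ∃ p, Tendsto γ atTop (𝓝 p)) (q : M) :
    ∀ᶠ t in atTop, ¬ R (γ t) q := by
  by_contra hq
  have hq' : ∀ t, R (γ t) q := fun t ↦ by
    obtain ⟨t', h1, h2⟩ := (Filter.frequently_atTop.1 (not_eventually.1 hq)) t
    exact h.trans (hmono t t' h1) (not_not.1 h2)
  have hC := h.isCompact (γ 0) q
  have hmem : ∀ᶠ t in atTop, γ t ∈ {z | R (γ 0) z ∧ R z q} :=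
    (eventually_ge_atTop 0).mono fun t ht ↦ ⟨hmono 0 t ht, hq' t⟩
  have hle : map γ atTop ≤ 𝓟 {z | R (γ 0) z ∧ R z q} := le_principal_iff.2 hmem
  obtain ⟨z, -, hz⟩ := hC.exists_clusterPt hle
  -- a cluster point of a monotone curve is an upper bound, and below every other upper bound
  have hub : ∀ z, ClusterPt z (map γ atTop) → ∀ t, R (γ t) z := fun z hz t ↦
    isClosed_iff_clusterPt.1 (h.isClosed_above (γ t)) z (hz.mono (le_principal_iff.2
      ((eventually_ge_atTop t).mono fun s hs ↦ hmono t s hs)))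
  have hlub : ∀ z, ClusterPt z (map γ atTop) → ∀ y, (∀ t, R (γ t) y) → R z y := fun z hz y hy ↦
    isClosed_iff_clusterPt.1 (h.isClosed_below y) z (hz.mono (le_principal_iff.2
      (show ∀ᶠ t in atTop, R (γ t) y from Eventually.of_forall hy)))
  refine hγ ⟨z, ?_⟩
  refine hC.le_nhds_of_unique_clusterPt hmem fun y _ hy ↦ ?_
  exact h.antisymm (hlub y hy z (hub z hz)) (hlub z hz y (hub y hy))

/-- There is a sequence whose open pasts cover the space and whose futures cover it as well. -/
theorem exists_seq [SecondCountableTopology M] [Nonempty M] (h : IsGloballyHyperbolicOrder R) :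
    ∃ q : ℕ → M, (∀ x, ∃ n, x ∈ interior {z | R z (q n)}) ∧ ∀ x, ∃ n, R (q n) x := by
  choose u hu using h.exists_mem_interior
  choose v hv using h.flip.exists_mem_interior
  obtain ⟨s, hs, hsu⟩ := TopologicalSpace.countable_cover_nhds
    (f := fun x ↦ interior {z | R z (u x)}) (fun x ↦ isOpen_interior.mem_nhds (hu x))
  obtain ⟨t, ht, htu⟩ := TopologicalSpace.countable_cover_nhds
    (f := fun x ↦ interior {z | R (v x) z}) (fun x ↦ isOpen_interior.mem_nhds (hv x))
  have x₀ : M := Classical.arbitrary M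
  obtain ⟨q, hq⟩ := (((hs.image u).union (ht.image v)).insert x₀).exists_eq_range ⟨x₀, by simp⟩
  refine ⟨q, fun x ↦ ?_, fun x ↦ ?_⟩
  · obtain ⟨y, hy, hxy⟩ := Set.mem_iUnion₂.1 (hsu ▸ Set.mem_univ x : x ∈ ⋃ y ∈ s, _)
    obtain ⟨n, hn⟩ : u y ∈ Set.range q := hq ▸ Or.inr (Or.inl ⟨y, hy, rfl⟩)
    exact ⟨n, hn ▸ hxy⟩
  · obtain ⟨y, hy, hxy⟩ := Set.mem_iUnion₂.1 (htu ▸ Set.mem_univ x : x ∈ ⋃ y ∈ t, _)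
    obtain ⟨n, hn⟩ : v y ∈ Set.range q := hq ▸ Or.inr (Or.inr ⟨y, hy, rfl⟩)
    exact ⟨n, hn ▸ interior_subset hxy⟩

/-- There is a set, disjoint from the past of a given compact set `K`, that every inextendible
curve which is monotone for the chronology relation meets exactly once.

Choose a sequence `q` as in `exists_seq`. Let `n⁺ x` be the least `n` with `x ≤ q n`, and `n⁻ x`
the least `n` with `q n ≤ x`. Along an inextendible curve `n⁺ - n⁻` increases from `-∞` to `∞`,
and `n⁺` is at most some `c` on the past of `K`. The set is the boundary of the future set
`F = {n⁺ > n⁻ + c}`. -/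
theorem exists_met_once [T2Space M] [SecondCountableTopology M] (h : IsGloballyHyperbolicOrder R)
    {K : Set M} (hK : IsCompact K) :
    ∃ Sig : Set M, (∀ x ∈ Sig, ∀ k ∈ K, ¬ R x k) ∧ ∀ γ : ℝ → M, Continuous γ →
      (∀ s t, s < t → γ s ∈ interior {z | R z (γ t)} ∧ γ t ∈ interior {z | R (γ s) z}) →
      (¬ ∃ p, Tendsto γ atTop (𝓝 p)) → (¬ ∃ p, Tendsto γ atBot (𝓝 p)) → ∃! t, γ t ∈ Sig := by
  rcases isEmpty_or_nonempty M with hM | hM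
  · exact ⟨∅, by simp, fun γ ↦ (hM.false (γ 0)).elim⟩
  obtain ⟨q, hq1, hq2⟩ := h.exists_seq
  obtain ⟨c, hc⟩ : ∃ c : ℕ, K ⊆ ⋃ k ≤ c, interior {z | R z (q k)} := by
    obtain ⟨T, hT⟩ := hK.elim_finite_subcover (fun n ↦ interior {z | R z (q n)})
      (fun n ↦ isOpen_interior) (fun x _ ↦ Set.mem_iUnion.2 (hq1 x))
    refine ⟨T.sup id, hT.trans ?_⟩
    exact Set.biUnion_subset_biUnion_left fun n hn ↦ Finset.le_sup (f := id) hn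
  -- `n⁺ x > n⁻ x + c`, without naming the least indices
  set F : Set M := {x | ∃ m, R (q m) x ∧ ∀ k ≤ c + m, ¬ R x (q k)} with hF
  have hFup : ∀ x ∈ F, ∀ y, R x y → y ∈ F := by
    rintro x ⟨m, hm, hk⟩ y hxy
    exact ⟨m, h.trans hm hxy, fun k hkm hyk ↦ hk k hkm (h.trans hxy hyk)⟩
  refine ⟨frontier F, fun x hx k hk hxk ↦ ?_, fun γ hγc hγ htop hbot ↦ ?_⟩
  · obtain ⟨n, hn, hkn⟩ := Set.mem_iUnion₂.1 (hc hk)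
    obtain ⟨y, hy, m, -, hm⟩ := mem_closure_iff_nhds.1 hx.1 _
      (mem_interior_iff_mem_nhds.1 (h.push_left hxk hkn))
    exact hm n (hn.trans (Nat.le_add_right _ _)) hy
  have hmono : ∀ s t, s ≤ t → R (γ s) (γ t) := fun s t hst ↦ by
    rcases hst.eq_or_lt with rfl | hst
    · exact h.refl _
    · exact interior_subset (s := {z | R z (γ t)}) (hγ s t hst).1
  have hcross : ∀ s t, s < t → γ s ∈ closure F → γ t ∈ interior F := fun s t hst hs ↦ by
    obtain ⟨r, hsr, hrt⟩ := exists_between hst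
    obtain ⟨y, hy, hyF⟩ := mem_closure_iff_nhds.1 hs _
      (mem_interior_iff_mem_nhds.1 (hγ s r hsr).1)
    exact interior_mono (fun z hz ↦ hFup _ (hFup y hyF _ hy) z hz) (hγ r t hrt).2
  have hin : ∃ t, γ t ∈ F := by
    obtain ⟨m, hm⟩ := hq2 (γ 0)
    have h1 : ∀ᶠ t in atTop, ∀ k ∈ Set.Iic (c + m), ¬ R (γ t) (q k) :=
      (eventually_all_finite (Set.finite_Iic _)).2 fun k _ ↦ h.eventually_not_rel hmono htop (q k)
    obtain ⟨t, ht1, ht2⟩ := (h1.and (eventually_ge_atTop 0)).exists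
    exact ⟨t, m, h.trans hm (hmono 0 t ht2), ht1⟩
  have hout : ∃ t, γ t ∉ F := by
    obtain ⟨n, hn⟩ := hq1 (γ 0)
    have h1 : ∀ᶠ t in atTop, ∀ k ∈ Set.Iic n, ¬ R (q k) (γ (-t)) :=
      (eventually_all_finite (Set.finite_Iic _)).2 fun k _ ↦
        h.flip.eventually_not_rel (γ := fun t ↦ γ (-t)) (fun s t hst ↦ hmono _ _ (neg_le_neg hst))
          (fun ⟨p, hp⟩ ↦ hbot ⟨p, by
            simpa [Function.comp_def] using hp.comp tendsto_neg_atBot_atTop⟩) (q k)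
    obtain ⟨t, ht1, ht2⟩ := (h1.and (eventually_ge_atTop 0)).exists
    refine ⟨-t, fun ⟨m, hm, hk⟩ ↦ ?_⟩
    rcases le_or_gt n (c + m) with hnm | hnm
    · exact hk n hnm (h.trans (hmono (-t) 0 (by linarith))
        (interior_subset (s := {z | R z (q n)}) hn))
    · exact ht1 m (by rw [Set.mem_Iic]; omega) hm
  obtain ⟨t₁, ht₁⟩ := hin
  obtain ⟨t₀, ht₀⟩ := hout
  have hfr : ∃ t, γ t ∈ frontier F := by
    by_contra! hno
    have hempty : frontier (γ ⁻¹' F) = ∅ := Set.subset_empty_iff.1 fun t ht ↦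
      hno t (hγc.frontier_preimage_subset F ht)
    rcases frontier_eq_empty_iff.1 hempty with h1 | h1
    · exact Set.notMem_empty t₁ (h1 ▸ ht₁)
    · exact ht₀ (Set.eq_univ_iff_forall.1 h1 t₀)
  obtain ⟨t, ht⟩ := hfr
  refine ⟨t, ht, fun s hs ↦ ?_⟩
  rcases lt_trichotomy s t with hst | hst | hst
  · exact (ht.2 (hcross s t hst hs.1)).elim
  · exact hst
  · exact (hs.2 (hcross t s hst ht.1)).elim

end IsGloballyHyperbolicOrder

/-! ### The exterior regions of a compact set -/

namespace Spacetime

variable {d : ℕ} {M : Type*} [TopologicalSpace M]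
  [ChartedSpace (EuclideanSpace ℝ (Fin d)) M] [IsManifold (𝓡 d) ∞ M] (S : Spacetime d M)

theorem GloballyHyperbolic.isGloballyHyperbolicOrder {S : Spacetime d M}
    (hS : S.GloballyHyperbolic) :
    IsGloballyHyperbolicOrder (Relation.ReflTransGen S.CausalStep) where
  refl _ := Relation.ReflTransGen.refl
  trans h1 h2 := h1.trans h2
  antisymm {x y} h1 h2 := by
    rcases Relation.reflTransGen_iff_eq_or_transGen.1 h1 with h | h
    · exact h.symm
    · exact (hS.1 x (h.trans_left h2)).elim
  isCompact := hS.2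
  mem_closure_right x := closure_mono (fun _ hy ↦ hy.1) (S.mem_closure_chron_right x)
  mem_closure_left x := closure_mono (fun _ hy ↦ hy.2) (S.mem_closure_chron_left x)
  push_left {x y z} h hy := by
    induction h using Relation.ReflTransGen.head_induction_on with
    | refl => exact hy
    | head h _ ih => exact h.mem_interior_JminusPt ih
  push_right {x y z} h hx := by
    induction h with
    | refl => exact hx
    | tail _ h ih => exact h.mem_interior_JplusPt ih

theorem IsInextendibleTimelike.chron {S : Spacetime d M} {γ : ℝ → M}
    (h : S.IsInextendibleTimelike γ) {s t : ℝ} (hst : s < t) : S.Chron (γ s) (γ t) := by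
  have key : ∀ a b, Relation.TransGen (S.IsTimelikeSegment γ) a b →
      S.Chron (γ a) (γ b) ∧ γ b ∈ S.JplusPt (γ a) := by
    intro a b hab
    induction hab with
    | single h => exact ⟨h.chron, h.isCausalSegment.mem_JplusPt le_rfl h.1.le le_rfl⟩
    | tail _ h ih =>
      have hstep := h.isCausalSegment.mem_JplusPt le_rfl h.1.le le_rfl
      exact ⟨⟨ih.1.trans_mem_right hstep, h.chron.trans_mem_left ih.2⟩, ih.2.trans hstep⟩
  exact (key s t (h.1 s t hst)).1

theorem IsInextendibleTimelike.continuous {S : Spacetime d M} {γ : ℝ → M}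
    (h : S.IsInextendibleTimelike γ) : Continuous γ := by
  have key : ∀ a b, Relation.TransGen (S.IsTimelikeSegment γ) a b →
      a < b ∧ ContinuousOn γ (Set.Icc a b) := by
    intro a b hab
    induction hab with
    | single h => exact ⟨h.1, h.2.1.continuousOn⟩
    | tail _ h ih =>
      refine ⟨ih.1.trans h.1, ?_⟩
      rw [← Set.Icc_union_Icc_eq_Icc ih.1.le h.1.le]
      exact ih.2.union_of_isClosed h.2.1.continuousOn isClosed_Icc isClosed_Icc
  rw [continuous_iff_continuousAt]
  intro t
  exact (key _ _ (h.1 (t - 1) (t + 1) (by linarith))).2.continuousAt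
    (Icc_mem_nhds (by linarith) (by linarith))

theorem subset_Jplus (R : Set M) : R ⊆ S.Jplus R := fun _ hx ↦
  Set.mem_biUnion hx Relation.ReflTransGen.refl

theorem subset_Jminus (R : Set M) : R ⊆ S.Jminus R := fun _ hx ↦
  Set.mem_biUnion hx Relation.ReflTransGen.refl

variable [T2Space M]

theorem GloballyHyperbolic.isClosed_Jminus {S : Spacetime d M} (hS : S.GloballyHyperbolic)
    {K : Set M} (hK : IsCompact K) : IsClosed (S.Jminus K) := by
  convert hS.isGloballyHyperbolicOrder.isClosed_below_of_isCompact hK using 1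
  ext x; simp [Jminus, JminusPt]

theorem GloballyHyperbolic.isClosed_Jplus {S : Spacetime d M} (hS : S.GloballyHyperbolic)
    {K : Set M} (hK : IsCompact K) : IsClosed (S.Jplus K) := by
  convert hS.isGloballyHyperbolicOrder.flip.isClosed_below_of_isCompact hK using 1
  ext x; simp [Jplus, JplusPt]

theorem GloballyHyperbolic.exists_isCauchySurface_subset_outRegion [SecondCountableTopology M]
    {S : Spacetime d M} (hS : S.GloballyHyperbolic) {K : Set M} (hK : IsCompact K) :
    ∃ Sig, S.IsCauchySurface Sig ∧ Sig ⊆ S.outRegion K := by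
  obtain ⟨Sig, h1, h2⟩ := hS.isGloballyHyperbolicOrder.exists_met_once hK
  refine ⟨Sig, fun γ hγ ↦ h2 γ hγ.continuous (fun s t hst ↦ hγ.chron hst) hγ.2.1 hγ.2.2,
    fun x hx hxK ↦ ?_⟩
  obtain ⟨k, hk, hxk⟩ := Set.mem_iUnion₂.1 hxK
  exact h1 x hx k hk hxk

theorem GloballyHyperbolic.exists_isCauchySurface_subset_inRegion [SecondCountableTopology M]
    {S : Spacetime d M} (hS : S.GloballyHyperbolic) {K : Set M} (hK : IsCompact K) :
    ∃ Sig, S.IsCauchySurface Sig ∧ Sig ⊆ S.inRegion K := by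
  obtain ⟨Sig, h1, h2⟩ := hS.isGloballyHyperbolicOrder.flip.exists_met_once hK
  refine ⟨Sig, fun γ hγ ↦ ?_, fun x hx hxK ↦ ?_⟩
  · -- the reversed curve is monotone for the reversed order
    obtain ⟨t, ht, huniq⟩ := h2 (fun t ↦ γ (-t)) (hγ.continuous.comp continuous_neg)
      (fun s t hst ↦ (hγ.chron (neg_lt_neg hst)).symm)
      (fun ⟨p, hp⟩ ↦ hγ.2.2 ⟨p, by
        simpa [Function.comp_def] using hp.comp tendsto_neg_atBot_atTop⟩)
      (fun ⟨p, hp⟩ ↦ hγ.2.1 ⟨p, by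
        simpa [Function.comp_def] using hp.comp tendsto_neg_atTop_atBot⟩)
    exact ⟨-t, ht, fun s hs ↦ by rw [← huniq (-s) (by simpa using hs), neg_neg]⟩
  · obtain ⟨k, hk, hxk⟩ := Set.mem_iUnion₂.1 hxK
    exact h1 x hx k hk hxk

/-- The future exterior region `M⁺(K)` of a compact set `K`. -/
def retardedRegion (hS : S.GloballyHyperbolic) {K : Set M} (hK : IsCompact K) : S.Region where
  carrier := S.outRegion K
  isOpen := (hS.isClosed_Jminus hK).isOpen_compl
  causallyConvex := by
    refine (Set.subset_inter (S.subset_Jplus _) (S.subset_Jminus _)).antisymm ?_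
    rintro x ⟨hx, -⟩ hxK
    obtain ⟨y, hy, hyx⟩ := Set.mem_iUnion₂.1 hx
    obtain ⟨k, hk, hxk⟩ := Set.mem_iUnion₂.1 hxK
    exact hy (Set.mem_biUnion hk (Relation.ReflTransGen.trans hyx hxk))

/-- The past exterior region `M⁻(K)` of a compact set `K`. -/
def advancedRegion (hS : S.GloballyHyperbolic) {K : Set M} (hK : IsCompact K) : S.Region where
  carrier := S.inRegion K
  isOpen := (hS.isClosed_Jplus hK).isOpen_compl
  causallyConvex := by
    refine (Set.subset_inter (S.subset_Jplus _) (S.subset_Jminus _)).antisymm ?_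
    rintro x ⟨-, hx⟩ hxK
    obtain ⟨y, hy, hyx⟩ := Set.mem_iUnion₂.1 hx
    obtain ⟨k, hk, hxk⟩ := Set.mem_iUnion₂.1 hxK
    exact hy (Set.mem_biUnion hk (Relation.ReflTransGen.trans hxk hyx))

end Spacetime

/-! ### Response maps and induced observables -/

section

variable {d : ℕ} {M : Type*} [TopologicalSpace M]
  [ChartedSpace (EuclideanSpace ℝ (Fin d)) M] [IsManifold (𝓡 d) ∞ M] {S : Spacetime d M}

theorem AQFT.incl_bijective (A : AQFT S) {N : S.Region}
    (hN : ∃ Sig : Set M, S.IsCauchySurface Sig ∧ Sig ⊆ N.carrier) :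
    Function.Bijective (A.incl N) :=
  ⟨A.map_injective _ _ _, fun a ↦ by
    have : a ∈ A.localAlg N := A.time_slice N hN ▸ trivial
    exact this⟩

theorem uncoupledMap_tmul (A B : AQFT S) (N₁ N₂ : S.Region) (h : N₂.carrier ⊆ N₁.carrier)
    (a : A.Obj N₂) (b : B.Obj N₂) :
    uncoupledMap A B N₁ N₂ h (a ⊗ₜ[ℂ] b) = A.map N₁ N₂ h a ⊗ₜ[ℂ] B.map N₁ N₂ h b := rfl

theorem uncoupledMap_uncoupledMap (A B : AQFT S) (N₁ N₂ N₃ : S.Region)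
    (h₁₂ : N₂.carrier ⊆ N₁.carrier) (h₂₃ : N₃.carrier ⊆ N₂.carrier)
    (x : A.Obj N₃ ⊗[ℂ] B.Obj N₃) :
    uncoupledMap A B N₁ N₂ h₁₂ (uncoupledMap A B N₂ N₃ h₂₃ x) =
      uncoupledMap A B N₁ N₃ (h₂₃.trans h₁₂) x := by
  induction x with
  | zero => simp
  | add x y hx hy => simp only [map_add, hx, hy]
  | tmul a b => simp only [uncoupledMap_tmul, LocalNet.map_map]

theorem uncoupledMap_star (A B : AQFT S) (N₁ N₂ : S.Region) (h : N₂.carrier ⊆ N₁.carrier)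
    (x : A.Obj N₂ ⊗[ℂ] B.Obj N₂) :
    uncoupledMap A B N₁ N₂ h (star x) = star (uncoupledMap A B N₁ N₂ h x) := by
  induction x with
  | zero => simp
  | add x y hx hy => rw [star_add, map_add, map_add, star_add, hx, hy]
  | tmul a b => simp [uncoupledMap_tmul, map_star]

theorem uncoupledMap_bijective (A B : AQFT S) {N : S.Region}
    (hN : ∃ Sig : Set M, S.IsCauchySurface Sig ∧ Sig ⊆ N.carrier) :
    Function.Bijective (uncoupledMap A B S.top N (Set.subset_univ _)) :=
  (TensorProduct.congr
    (LinearEquiv.ofBijective (A.incl N).toAlgHom.toLinearMap (A.incl_bijective hN))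
    (LinearEquiv.ofBijective (B.incl N).toAlgHom.toLinearMap (B.incl_bijective hN))).bijective

theorem etaMap_mul_tmul_one (A B : AQFT S) (σ : AlgState B.Global)
    (x : A.Global ⊗[ℂ] B.Global) (a : A.Global) :
    etaMap A B σ (x * a ⊗ₜ[ℂ] 1) = etaMap A B σ x * a := by
  induction x with
  | zero => simp
  | add x y hx hy => rw [add_mul, map_add, map_add, add_mul, hx, hy]
  | tmul a' b => simp [etaMap_tmul]

theorem etaMap_tmul_one_mul (A B : AQFT S) (σ : AlgState B.Global)
    (x : A.Global ⊗[ℂ] B.Global) (a : A.Global) :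
    etaMap A B σ (a ⊗ₜ[ℂ] 1 * x) = a * etaMap A B σ x := by
  induction x with
  | zero => simp
  | add x y hx hy => rw [mul_add, map_add, map_add, mul_add, hx, hy]
  | tmul a' b => simp [etaMap_tmul]

namespace Coupling

variable {A B C : AQFT S} {K : Set M} (X : Coupling A B C K)

theorem existsUnique_isResponseMap {N : S.Region} (hNK : N.carrier ⊆ (S.causalHull K)ᶜ)
    (hN : ∃ Sig : Set M, S.IsCauchySurface Sig ∧ Sig ⊆ N.carrier) :
    ∃! τ : (A.Global ⊗[ℂ] B.Global) ≃⋆ₐ[ℂ] C.Global, X.IsResponseMap N.carrier τ := by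
  have hu := uncoupledMap_bijective A B hN
  let e : (A.Obj N ⊗[ℂ] B.Obj N) ≃⋆ₐ[ℂ] (A.Global ⊗[ℂ] B.Global) :=
    StarAlgEquiv.ofBijective
      (⟨uncoupledMap A B S.top N (Set.subset_univ _), uncoupledMap_star A B _ _ _⟩ :
        (A.Obj N ⊗[ℂ] B.Obj N) →⋆ₐ[ℂ] (A.Global ⊗[ℂ] B.Global)) hu
  refine ⟨(e.symm.trans (X.chi N hNK)).trans
    (StarAlgEquiv.ofBijective (C.incl N) (C.incl_bijective hN)), ⟨N, hNK, rfl, hu, fun x ↦ ?_⟩, ?_⟩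
  · have : e.symm (uncoupledMap A B S.top N (Set.subset_univ _) x) = x := e.symm_apply_apply x
    simp [this]
  · rintro τ ⟨N', hN', hc, -, hτ⟩
    obtain rfl : N' = N := by cases N; cases N'; cases hc; rfl
    ext y
    obtain ⟨x, rfl⟩ := hu.2 y
    rw [hτ]
    have : e.symm (uncoupledMap A B S.top N' (Set.subset_univ _) x) = x := e.symm_apply_apply x
    simp [this]

/-- On observables localized in a smaller region, a response map is given by the identification
for that region: naturality of the coupling makes the choice of the large region irrelevant. -/
theorem IsResponseMap.apply_of_subset {X : Coupling A B C K} {R : Set M}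
    {τ : (A.Global ⊗[ℂ] B.Global) ≃⋆ₐ[ℂ] C.Global}
    (hτ : X.IsResponseMap R τ) {N : S.Region} (hNR : N.carrier ⊆ R)
    (hN : N.carrier ⊆ (S.causalHull K)ᶜ) (x : A.Obj N ⊗[ℂ] B.Obj N) :
    τ (uncoupledMap A B S.top N (Set.subset_univ _) x) = C.incl N (X.chi N hN x) := by
  obtain ⟨L, hL, rfl, -, h⟩ := hτ
  have h1 : uncoupledMap A B S.top N (Set.subset_univ _) x =
      uncoupledMap A B S.top L (Set.subset_univ _) (uncoupledMap A B L N hNR x) :=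
    (uncoupledMap_uncoupledMap A B S.top L N (Set.subset_univ _) hNR x).symm
  rw [h1, h, X.natural L N hNR hL hN]
  exact C.map_map S.top L N _ hNR _

/-- The causal complement of `K` lies in both exterior regions, so that both response maps agree
there and scattering is trivial. -/
theorem scatteringMorphism_tmul_one {τp τm : (A.Global ⊗[ℂ] B.Global) ≃⋆ₐ[ℂ] C.Global}
    (hp : X.IsRetardedResponse τp) (hm : X.IsAdvancedResponse τm) {N : S.Region}
    (hN : N.carrier ⊆ S.causalComplement K) {a : A.Global} (ha : a ∈ A.localAlg N) :
    scatteringMorphism τp τm (a ⊗ₜ[ℂ] 1) = a ⊗ₜ[ℂ] 1 := by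
  obtain ⟨a, rfl⟩ := ha
  have hin : N.carrier ⊆ S.inRegion K := fun x hx h ↦ hN hx (Or.inl h)
  have hout : N.carrier ⊆ S.outRegion K := fun x hx h ↦ hN hx (Or.inr h)
  have hhull : N.carrier ⊆ (S.causalHull K)ᶜ := fun x hx h ↦ hin hx h.1
  have h1 : (A.incl N a ⊗ₜ[ℂ] (1 : B.Global)) =
      uncoupledMap A B S.top N (Set.subset_univ _) (a ⊗ₜ[ℂ] 1) := by
    rw [← map_one (B.incl N)]
    rfl
  change τm.symm (τp (A.incl N a ⊗ₜ[ℂ] (1 : B.Global))) = A.incl N a ⊗ₜ[ℂ] (1 : B.Global)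
  rw [h1, hp.apply_of_subset hout hhull, ← hm.apply_of_subset hin hhull]
  exact τm.symm_apply_apply _

theorem commute_inducedObservable {τp τm : (A.Global ⊗[ℂ] B.Global) ≃⋆ₐ[ℂ] C.Global}
    (hp : X.IsRetardedResponse τp) (hm : X.IsAdvancedResponse τm) (σ : AlgState B.Global)
    (b : B.Global) {N : S.Region}
    (hN : N.carrier ⊆ S.causalComplement K) {a : A.Global} (ha : a ∈ A.localAlg N) :
    Commute (inducedObservable A B (scatteringMorphism τp τm) σ b) a := by
  have h := X.scatteringMorphism_tmul_one hp hm hN ha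
  unfold Commute SemiconjBy inducedObservable
  rw [← etaMap_mul_tmul_one, ← etaMap_tmul_one_mul, ← h, ← map_mul, ← map_mul]
  simp

end Coupling

/-- A functional that restricts to a product state along `τ` is determined by `η_σ`. -/
theorem apply_eq_apply_etaMap {A B C : AQFT S} {τ : (A.Global ⊗[ℂ] B.Global) ≃⋆ₐ[ℂ] C.Global}
    {σ : AlgState B.Global} {ρ : AlgState A.Global} {ρ' : AlgState C.Global}
    (h : ∀ (a : A.Global) (b : B.Global), ρ'.toFun (τ (a ⊗ₜ[ℂ] b)) = ρ.toFun a * σ.toFun b)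
    (x : A.Global ⊗[ℂ] B.Global) : ρ'.toFun (τ x) = ρ.toFun (etaMap A B σ x) := by
  induction x with
  | zero => simp
  | add x y hx hy => simp only [map_add, hx, hy]
  | tmul a b => rw [h, etaMap_tmul, map_smul, smul_eq_mul, mul_comm]

end

theorem mainTheorem2 {d : ℕ} {M : Type*} [TopologicalSpace M] [T2Space M]
    [SecondCountableTopology M] [ChartedSpace (EuclideanSpace ℝ (Fin d)) M]
    [IsManifold (𝓡 d) ∞ M] (S : Spacetime d M) (hS : S.GloballyHyperbolic)
    (K : Set M) (hK : IsCompact K) (A B C : AQFT S) (X : Coupling A B C K) :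
    (∃! τ : (A.Global ⊗[ℂ] B.Global) ≃⋆ₐ[ℂ] C.Global, X.IsRetardedResponse τ) ∧
    (∃! τ : (A.Global ⊗[ℂ] B.Global) ≃⋆ₐ[ℂ] C.Global, X.IsAdvancedResponse τ) ∧
    ∀ τp τm : (A.Global ⊗[ℂ] B.Global) ≃⋆ₐ[ℂ] C.Global,
      X.IsRetardedResponse τp → X.IsAdvancedResponse τm →
      ∀ (σ : AlgState B.Global) (b : B.Global),
        -- `ε_σ(b)` is the system observable that is measured by `b`
        (∀ (ρ : AlgState A.Global) (ρ' : AlgState C.Global),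
          (∀ (a : A.Global) (b' : B.Global),
            ρ'.toFun (τm (a ⊗ₜ[ℂ] b')) = ρ.toFun a * σ.toFun b') →
          ρ'.toFun (τp (1 ⊗ₜ[ℂ] b)) =
            ρ.toFun (inducedObservable A B (scatteringMorphism τp τm) σ b)) ∧
        -- it commutes with the observables localized in the causal complement of `K`
        (∀ N : S.Region, N.carrier ⊆ S.causalComplement K → ∀ a ∈ A.localAlg N,
          Commute (inducedObservable A B (scatteringMorphism τp τm) σ b) a) ∧
        -- it can be localized in every connected open causally convex region containing `K`
        (∀ L : S.Region, IsConnected L.carrier → K ⊆ L.carrier →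
          inducedObservable A B (scatteringMorphism τp τm) σ b ∈ A.localAlg L) := by
  have hout := hS.exists_isCauchySurface_subset_outRegion hK
  have hin := hS.exists_isCauchySurface_subset_inRegion hK
  refine ⟨X.existsUnique_isResponseMap (N := S.retardedRegion hS hK) (fun x hx h ↦ hx h.2) hout,
    X.existsUnique_isResponseMap (N := S.advancedRegion hS hK) (fun x hx h ↦ hx h.1) hin,
    fun τp τm hp hm σ b ↦ ⟨fun ρ ρ' h ↦ ?_, fun N hN a ha ↦
      X.commute_inducedObservable hp hm σ b hN ha, fun L hL hKL ↦
      A.haag K hK _ (fun N hN a ha ↦ X.commute_inducedObservable hp hm σ b hN ha) L hL hKL⟩⟩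
  rw [inducedObservable, ← apply_eq_apply_etaMap h]
  exact congrArg ρ'.toFun (τm.apply_symm_apply _).symm
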